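/- **Setting.** Let $x_{t+1}=Ax_t+Bu_t+w_{t+1}$, $y_t=Cx_t+v_t$ with $x_t\in\mathbb R^n$, $u_t\in\mathbb R^p$, $y_t\in\mathbb R^m$ and $x_0$ deterministic. Let the pairs $(w_k,v_k)$, $k\ge 0$, be i.i.d. jointly Gaussian with mean $(\bar w,0)$ and covariance $\begin{pmatrix}W&0\\0&S\end{pmatrix}$. Let $Q\succeq 0$ and $R\succ 0$ be symmetric, $N\in\mathbb N$ a horizon, $\epsilon\in\mathbb R$, $\mu\ge 0$. Put $\mathcal F_t=\sigma(y_{0:t},u_{0:t})$, with $\mathcal F_{-1}$ trivial, and let $\mathcal U_0$ be the set of controls $u=(u_0,\dots,u_{N-1})$ such that each $u_t$ is measurable with respect to $\sigma(y_{0:t},u_{0:t-1})$ and $\mathbb E\|u_t\|^4<\infty$. For $u\in\mathcal U_0$ let $\hat x_{t|t}=\mathbb E(x_t|\mathcal F_t)$, $\hat x_t=\mathbb E(x_t|\mathcal F_{t-1})$, $\delta_t=x_t-\hat x_t$ and $$\begin{aligned} \Omega_t&=\mathbb E(\delta_{t+1}\delta_{t+1}'|\mathcal F_t),\qquad m_{3,t}=2Q\,\mathbb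 E(\delta_{t+1}\delta_{t+1}'Q\delta_{t+1}|\mathcal F_t),\\ m_{4,t}&=\mathbb E\big((\delta_{t+1}'Q\delta_{t+1}-\mathrm{Tr}(Q\Omega_t))^2|\mathcal F_t\big),\\ J(u)&=\mathbb E\Big\{x_N'Qx_N+\sum_{t=0}^{N-1}\big(x_t'Qx_t+u_t'Ru_t\big)\Big\},\\ J_R(u)&=\mathbb E\sum_{t=1}^{N}\big(4\hat x_t'Q\Omega_{t-1}Q\hat x_t+2\hat x_t'm_{3,t-1}\big),\\ \mathcal L(u,\mu)&=J(u)+\mu J_R(u)-\mu\bar\epsilon,\qquad \bar\epsilon=\epsilon-\sum_{t=1}^N\mathbb E\,m_{4,t-1},\\ D(\mu)&=\inf_{u\in\mathcal U_0}\mathcal L(u,\mu)\in[-\infty,\infty). \end{aligned}$$ Define the Kalman filter recursion $W_0=0$, $$W_{t+1}=AW_tA'+W-AW_tC'(CW_tC'+S)^{-1}CW_tA',$$ and assume that $CW_tC'+S$ is invertible for $1\le t\le N-1$ (this holds, for instance, if $S\succ 0$; for $t=0$ all terms with the inverse contain the factor $W_0=0$ and are read as $0$). **Theorem (LQG risk-aware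 controllers).** 1. For every $u\in\mathcal U_0$ the innovations $\delta_0,\dots,\delta_N$ are jointly Gaussian, and for each $t\le N$ the innovation $\delta_t$ has mean $0$ and covariance $W_t$ and is independent of the past $\mathcal F_{t-1}$. In particular, $\Omega_t=W_{t+1}$ almost surely for $t\le N-1$. 2. For every $u\in\mathcal U_0$ and $t\le N-1$, almost surely, $$\hat x_{t|t}=\hat x_t+W_tC'(CW_tC'+S)^{-1}(y_t-C\hat x_t).$$ 3. Put $Q_{\mu,t}=Q+4\mu\,QW_{t+1}Q$ (that is, $Q+4\mu\,Q\Omega_tQ$), and for $t\le N-1$ define backwards $$\begin{aligned} V_{t-1}&=(A+BK_t)'V_t(A+BK_t)+K_t'RK_t+Q_{\mu,t-1},& V_{N-1}&=Q_{\mu,N-1},\\ \xi_{t-1}&=(A+BK_t)'(\xi_t+V_t\bar w),&\xi_{N-1}&=0,\\ K_t&=-(B'V_tB+R)^{-1}B'V_tA,\\ l_t&=-(B'V_tB+R)^{-1}B'(\xi_t+V_t\bar w). \end{aligned}$$ Then there is a control $u^*\in\mathcal U_0$ with $u^*_t=K_t\hat x_{t|t}+l_t$ almost surely for all $t\le N-1$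 (where $\hat x_{t|t}$ is the state estimate in the closed loop under $u^*$), and every such control is optimal: $\mathcal L(u^*,\mu)=D(\mu)$. -/

import Mathlib

open MeasureTheory ProbabilityTheory Matrix

/-- Data of a finite-horizon partially observed linear-quadratic problem on a sample space `Ω`:
the system `x_{t+1} = A x_t + B u_t + w_{t+1}`, `y_t = C x_t + v_t` with deterministic initial
state `x0`, penalties `Q`, `R`, horizon `N`, risk level `eps`, and noise processes `w`, `v`.
Vectors are elements of `Fin k → ℝ`; the choice of a norm on them plays no role (only
measurability, Gaussianity, expectations and the finiteness of moments are used). -/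
structure LQProblem (n m p : ℕ) (Ω : Type*) where
  A : Matrix (Fin n) (Fin n) ℝ
  B : Matrix (Fin n) (Fin p) ℝ
  C : Matrix (Fin m) (Fin n) ℝ
  Q : Matrix (Fin n) (Fin n) ℝ
  R : Matrix (Fin p) (Fin p) ℝ
  x0 : Fin n → ℝ
  N : ℕ
  eps : ℝ
  w : ℕ → Ω → Fin n → ℝ
  v : ℕ → Ω → Fin m → ℝ

/-- The pairs `(w_k, v_k)` are i.i.d. (equality of the laws comes from equality of their first and
second moments) jointly Gaussian vectors with mean `(wbar, 0)` and covariance `diag (W, S)`. -/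
structure IsGaussianNoise {n m : ℕ} {Ω : Type*} [MeasurableSpace Ω] (P : Measure Ω)
    (w : ℕ → Ω → Fin n → ℝ) (v : ℕ → Ω → Fin m → ℝ) (wbar : Fin n → ℝ)
    (W : Matrix (Fin n) (Fin n) ℝ) (S : Matrix (Fin m) (Fin m) ℝ) : Prop where
  measurable_w : ∀ k, Measurable (w k)
  measurable_v : ∀ k, Measurable (v k)
  indep : iIndepFun (fun k ω => (w k ω, v k ω)) P
  gaussian : ∀ k, HasGaussianLaw (fun ω => (w k ω, v k ω)) P
  mean_w : ∀ k i, ∫ ω, w k ω i ∂P = wbar i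
  mean_v : ∀ k i, ∫ ω, v k ω i ∂P = 0
  cov_w : ∀ k i j, covariance (fun ω => w k ω i) (fun ω => w k ω j) P = W i j
  cov_wv : ∀ k i j, covariance (fun ω => w k ω i) (fun ω => v k ω j) P = 0
  cov_v : ∀ k i j, covariance (fun ω => v k ω i) (fun ω => v k ω j) P = S i j

namespace LQProblem

variable {n m p : ℕ} {Ω : Type*}

/-- The state process driven by the control process `u`. -/
def state (D : LQProblem n m p Ω) (u : ℕ → Ω → Fin p → ℝ) : ℕ → Ω → Fin n → ℝ
  | 0 => fun _ => D.x0
  | t + 1 => fun ω => D.A *ᵥ D.state u t ω + D.B *ᵥ u t ω + D.w (t + 1) ω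

/-- The measured output. -/
def output (D : LQProblem n m p Ω) (u : ℕ → Ω → Fin p → ℝ) (t : ℕ) (ω : Ω) : Fin m → ℝ :=
  D.C *ᵥ D.state u t ω + D.v t ω

/-- The σ-algebra `σ(y_{0:t}, u_{0:t-1})` of the information on which `u_t` may be based. -/
@[reducible] def obsInfo (D : LQProblem n m p Ω) (u : ℕ → Ω → Fin p → ℝ) (t : ℕ) : MeasurableSpace Ω :=
  (⨆ s ∈ Set.Iic t, MeasurableSpace.comap (D.output u s) inferInstance) ⊔
    ⨆ s ∈ Set.Iio t, MeasurableSpace.comap (u s) inferInstance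

/-- The σ-algebra `F_t = σ(y_{0:t}, u_{0:t})`. -/
@[reducible] def info (D : LQProblem n m p Ω) (u : ℕ → Ω → Fin p → ℝ) (t : ℕ) : MeasurableSpace Ω :=
  (⨆ s ∈ Set.Iic t, MeasurableSpace.comap (D.output u s) inferInstance) ⊔
    ⨆ s ∈ Set.Iic t, MeasurableSpace.comap (u s) inferInstance

/-- The σ-algebra `F_{t-1}`, where `F_{-1}` is trivial. -/
@[reducible] def pastInfo (D : LQProblem n m p Ω) (u : ℕ → Ω → Fin p → ℝ) : ℕ → MeasurableSpace Ω
  | 0 => ⊥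
  | t + 1 => D.info u t

/-- The policy set `U_0`: causal controls with finite fourth moments. Only
`u_0, …, u_{N-1}` matter. -/
def admissible [MeasurableSpace Ω] (D : LQProblem n m p Ω) (P : Measure Ω) :
    Set (ℕ → Ω → Fin p → ℝ) :=
  {u | ∀ t < D.N, Measurable[D.obsInfo u t] (u t) ∧ MemLp (u t) 4 P}

section Estimation

variable [MeasurableSpace Ω]

/-- The state estimate `x̂_{t|t} = E(x_t | F_t)`. -/
noncomputable def estimate (D : LQProblem n m p Ω) (P : Measure Ω) (u : ℕ → Ω → Fin p → ℝ)
    (t : ℕ) : Ω → Fin n → ℝ :=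
  condExp (D.info u t) P (D.state u t)

/-- The state prediction `x̂_t = E(x_t | F_{t-1})`. -/
noncomputable def prediction (D : LQProblem n m p Ω) (P : Measure Ω) (u : ℕ → Ω → Fin p → ℝ)
    (t : ℕ) : Ω → Fin n → ℝ :=
  condExp (D.pastInfo u t) P (D.state u t)

/-- The innovation `δ_t = x_t - x̂_t`. -/
noncomputable def innovation (D : LQProblem n m p Ω) (P : Measure Ω) (u : ℕ → Ω → Fin p → ℝ)
    (t : ℕ) (ω : Ω) : Fin n → ℝ :=
  D.state u t ω - D.prediction P u t ω

/-- The conditional second moment `E(δ_{t+1} δ_{t+1}' | F_t)`. -/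
noncomputable def condCov (D : LQProblem n m p Ω) (P : Measure Ω) (u : ℕ → Ω → Fin p → ℝ)
    (t : ℕ) (ω : Ω) : Matrix (Fin n) (Fin n) ℝ :=
  Matrix.of fun i j =>
    condExp (D.info u t) P (fun ω' => D.innovation P u (t + 1) ω' i * D.innovation P u (t + 1) ω' j) ω

/-- The conditional third moment `m_{3,t} = 2 Q E(δ_{t+1} δ_{t+1}' Q δ_{t+1} | F_t)`. -/
noncomputable def condThird (D : LQProblem n m p Ω) (P : Measure Ω) (u : ℕ → Ω → Fin p → ℝ)
    (t : ℕ) (ω : Ω) : Fin n → ℝ :=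
  (2 : ℝ) • D.Q *ᵥ condExp (D.info u t) P
    (fun ω' => (D.innovation P u (t + 1) ω' ⬝ᵥ D.Q *ᵥ D.innovation P u (t + 1) ω') •
      D.innovation P u (t + 1) ω') ω

/-- The conditional fourth moment
`m_{4,t} = E((δ_{t+1}' Q δ_{t+1} - Tr (Q E(δ_{t+1} δ_{t+1}' | F_t)))² | F_t)`. -/
noncomputable def condFourth (D : LQProblem n m p Ω) (P : Measure Ω) (u : ℕ → Ω → Fin p → ℝ)
    (t : ℕ) : Ω → ℝ :=
  condExp (D.info u t) P (fun ω' =>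
    (D.innovation P u (t + 1) ω' ⬝ᵥ D.Q *ᵥ D.innovation P u (t + 1) ω'
      - (D.Q * D.condCov P u t ω').trace) ^ 2)

/-- The linear-quadratic cost `J(u)`. -/
noncomputable def cost (D : LQProblem n m p Ω) (P : Measure Ω) (u : ℕ → Ω → Fin p → ℝ) : ℝ :=
  ∫ ω, (D.state u D.N ω ⬝ᵥ D.Q *ᵥ D.state u D.N ω
    + ∑ t ∈ Finset.range D.N,
        (D.state u t ω ⬝ᵥ D.Q *ᵥ D.state u t ω + u t ω ⬝ᵥ D.R *ᵥ u t ω)) ∂P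

/-- The risk functional `J_R(u)`. -/
noncomputable def risk (D : LQProblem n m p Ω) (P : Measure Ω) (u : ℕ → Ω → Fin p → ℝ) : ℝ :=
  ∫ ω, (∑ t ∈ Finset.range D.N,
    (4 * (D.prediction P u (t + 1) ω ⬝ᵥ
        (D.Q * D.condCov P u t ω * D.Q) *ᵥ D.prediction P u (t + 1) ω)
      + 2 * (D.prediction P u (t + 1) ω ⬝ᵥ D.condThird P u t ω))) ∂P

/-- The modified risk level `ε̄ = ε - ∑_{t=1}^N E m_{4,t-1}`. -/
noncomputable def epsBar (D : LQProblem n m p Ω) (P : Measure Ω) (u : ℕ → Ω → Fin p → ℝ) : ℝ :=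
  D.eps - ∑ t ∈ Finset.range D.N, ∫ ω, D.condFourth P u t ω ∂P

/-- The Lagrangian `L(u, μ) = J(u) + μ J_R(u) - μ ε̄`. -/
noncomputable def lagrangian (D : LQProblem n m p Ω) (P : Measure Ω) (u : ℕ → Ω → Fin p → ℝ)
    (mu : ℝ) : ℝ :=
  D.cost P u + mu * D.risk P u - mu * D.epsBar P u

/-- The dual function `D(μ) = inf_{u ∈ U_0} L(u, μ)`, in the extended reals. -/
noncomputable def dualValue (D : LQProblem n m p Ω) (P : Measure Ω) (mu : ℝ) : EReal :=
  ⨅ u ∈ D.admissible P, ((D.lagrangian P u mu : ℝ) : EReal)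

end Estimation

section Recursions

/-- The Kalman filter covariance `W_t`, with `W_0 = 0`. -/
noncomputable def kalmanCov (D : LQProblem n m p Ω) (W : Matrix (Fin n) (Fin n) ℝ)
    (S : Matrix (Fin m) (Fin m) ℝ) : ℕ → Matrix (Fin n) (Fin n) ℝ
  | 0 => 0
  | t + 1 => D.A * D.kalmanCov W S t * D.Aᵀ + W
      - D.A * D.kalmanCov W S t * D.Cᵀ * (D.C * D.kalmanCov W S t * D.Cᵀ + S)⁻¹
        * D.C * D.kalmanCov W S t * D.Aᵀ

/-- The filter gain `W_t C' (C W_t C' + S)⁻¹`. -/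
noncomputable def kalmanGain (D : LQProblem n m p Ω) (W : Matrix (Fin n) (Fin n) ℝ)
    (S : Matrix (Fin m) (Fin m) ℝ) (t : ℕ) : Matrix (Fin n) (Fin m) ℝ :=
  D.kalmanCov W S t * D.Cᵀ * (D.C * D.kalmanCov W S t * D.Cᵀ + S)⁻¹

/-- The inflated penalty `Q_{μ,t} = Q + 4 μ Q E(δ_{t+1} δ_{t+1}' | F_t) Q`; the conditional
covariance of `δ_{t+1}` is the value of the Kalman recursion at time `t + 1`. -/
noncomputable def inflatedQ (D : LQProblem n m p Ω) (W : Matrix (Fin n) (Fin n) ℝ)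
    (S : Matrix (Fin m) (Fin m) ℝ) (mu : ℝ) (t : ℕ) : Matrix (Fin n) (Fin n) ℝ :=
  D.Q + (4 * mu) • (D.Q * D.kalmanCov W S (t + 1) * D.Q)

/-- The feedback gain `-(B'VB + R)⁻¹ B'VA` attached to a cost matrix `V`. -/
noncomputable def gainOf (D : LQProblem n m p Ω) (V : Matrix (Fin n) (Fin n) ℝ) :
    Matrix (Fin p) (Fin n) ℝ :=
  -((D.Bᵀ * V * D.B + D.R)⁻¹ * (D.Bᵀ * V * D.A))

/-- The backward recursion for `V_t`, `t ≤ N - 1`: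
`V_{N-1} = Q_{μ,N-1}` and
`V_t = (A + B K_{t+1})' V_{t+1} (A + B K_{t+1}) + K_{t+1}' R K_{t+1} + Q_{μ,t}`. -/
noncomputable def costMat (D : LQProblem n m p Ω) (W : Matrix (Fin n) (Fin n) ℝ)
    (S : Matrix (Fin m) (Fin m) ℝ) (mu : ℝ) (t : ℕ) : Matrix (Fin n) (Fin n) ℝ :=
  if t + 1 < D.N then
    (D.A + D.B * D.gainOf (D.costMat W S mu (t + 1)))ᵀ * D.costMat W S mu (t + 1)
        * (D.A + D.B * D.gainOf (D.costMat W S mu (t + 1)))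
      + (D.gainOf (D.costMat W S mu (t + 1)))ᵀ * D.R * D.gainOf (D.costMat W S mu (t + 1))
      + D.inflatedQ W S mu t
  else D.inflatedQ W S mu t
termination_by D.N - t

/-- The control gain `K_t = -(B'V_tB + R)⁻¹ B'V_tA`. -/
noncomputable def controlGain (D : LQProblem n m p Ω) (W : Matrix (Fin n) (Fin n) ℝ)
    (S : Matrix (Fin m) (Fin m) ℝ) (mu : ℝ) (t : ℕ) : Matrix (Fin p) (Fin n) ℝ :=
  D.gainOf (D.costMat W S mu t)

/-- The backward recursion for `ξ_t`, `t ≤ N - 1`: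
`ξ_{N-1} = 0` and `ξ_t = (A + B K_{t+1})' (ξ_{t+1} + V_{t+1} wbar)`. -/
noncomputable def costVec (D : LQProblem n m p Ω) (wbar : Fin n → ℝ)
    (W : Matrix (Fin n) (Fin n) ℝ) (S : Matrix (Fin m) (Fin m) ℝ) (mu : ℝ) (t : ℕ) :
    Fin n → ℝ :=
  if t + 1 < D.N then
    (D.A + D.B * D.controlGain W S mu (t + 1))ᵀ *ᵥ
      (D.costVec wbar W S mu (t + 1) + D.costMat W S mu (t + 1) *ᵥ wbar)
  else 0
termination_by D.N - t

/-- The affine control term `l_t = -(B'V_tB + R)⁻¹ B' (ξ_t + V_t wbar)`. -/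
noncomputable def controlShift (D : LQProblem n m p Ω) (wbar : Fin n → ℝ)
    (W : Matrix (Fin n) (Fin n) ℝ) (S : Matrix (Fin m) (Fin m) ℝ) (mu : ℝ) (t : ℕ) :
    Fin p → ℝ :=
  -((D.Bᵀ * D.costMat W S mu t * D.B + D.R)⁻¹ *ᵥ
    (D.Bᵀ *ᵥ (D.costVec wbar W S mu t + D.costMat W S mu t *ᵥ wbar)))

/-- `u_t = K_t x̂_{t|t} + l_t` almost surely for `t ≤ N - 1`, where `x̂_{t|t}` is the state estimate
in the closed loop, under `u` itself. -/
def IsRiskAwareControl [MeasurableSpace Ω] (D : LQProblem n m p Ω) (P : Measure Ω)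
    (wbar : Fin n → ℝ) (W : Matrix (Fin n) (Fin n) ℝ) (S : Matrix (Fin m) (Fin m) ℝ) (mu : ℝ)
    (u : ℕ → Ω → Fin p → ℝ) : Prop :=
  ∀ t < D.N, ∀ᵐ ω ∂P,
    u t ω = D.controlGain W S mu t *ᵥ D.estimate P u t ω + D.controlShift wbar W S mu t

end Recursions

end LQProblem

/-!
The argument rests on the Kalman filter in innovation form. Let `e_t` be the process driven by the
centred noise alone through `e_0 = 0` and
`e_{t+1} = A (e_t - L_t (C e_t + v_t)) + (w_{t+1} - wbar)`, where `L_t` is the filter gain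
(`filterError`), and call `C e_t + v_t` the residual. Whatever the control, the state splits as
`x_t = b_t + e_t`, where the predictor `b_t` is computed from the controls and the residuals before
time `t` (`state_eq_add`), and `y_t = C b_t + (C e_t + v_t)`.

*Estimation.* Outputs and residuals determine each other once the past controls are known, and
causal controls are functions of the outputs. Hence for every admissible control the σ-algebra
`F_t` is the one generated by the residuals up to time `t` (`info_eq_residualInfo`), which does not
depend on the control. All `e_t` and residuals lie in the linear span of the noise coordinates and
are therefore jointly Gaussian. The normal equation `L_t (C W_t C' + S) = W_t C'` makes `e_t`
uncorrelated with the earlier residuals and gives it covariance `W_t` (`crossCov_filterError`);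
being jointly Gaussian, they are independent (`indep_residualInfo`). So `b_t` is the prediction,
`e_t` is the innovation up to a null set, and `b_t + L_t (C e_t + v_t)` is the estimate
`E(x_t | F_t)`, because `e_t - L_t (C e_t + v_t)` is independent of `F_t` by the same reasoning.

*Control.* Conditional moments of the innovation are constants. The third one vanishes by symmetry
(`condThird_ae_eq_zero`), and the covariance turns the penalty `Q` into `Q_{μ,t}`. What remains of
the Lagrangian is a linear-quadratic problem for the predictor with full information, in which the
filter correction `L_t (C e_t + v_t)` acts as independent centred noise. Completing the square at
each step (`completion_of_squares`, `bellman_step`) and telescoping expresses the Lagrangian as a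
constant plus the sum of the integrals of
`(u_t - K_t a_t - l_t)' (B' V_t B + R) (u_t - K_t a_t - l_t)`, where `a_t` is the estimate
(`exists_lagrangian_eq`). These are nonnegative and vanish for the affine feedback. Such a
feedback exists since the predictor in closed loop can be defined recursively from the residuals
(`closedLoopControl`).
-/

/-! ### Vectors generated linearly by a space of random variables -/

namespace ProbabilityTheory

section LinearlyGenerated

variable {Ω E F : Type*} [NormedAddCommGroup E] [NormedSpace ℝ E]
  [NormedAddCommGroup F] [NormedSpace ℝ F] {V : Submodule ℝ (Ω → ℝ)}

/-- Every continuous linear functional of the random vector `X` lies in the linear space `V` of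
real random variables. -/
def LinearlyGenerated (V : Submodule ℝ (Ω → ℝ)) (X : Ω → E) : Prop :=
  ∀ L : StrongDual ℝ E, (fun ω => L (X ω)) ∈ V

lemma LinearlyGenerated.map {X : Ω → E} (h : LinearlyGenerated V X) (T : E →L[ℝ] F) :
    LinearlyGenerated V (fun ω => T (X ω)) := fun L => h (L ∘L T)

lemma LinearlyGenerated.add {X Y : Ω → E} (hX : LinearlyGenerated V X)
    (hY : LinearlyGenerated V Y) : LinearlyGenerated V (fun ω => X ω + Y ω) := fun L => by
  simpa only [map_add] using! V.add_mem (hX L) (hY L)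

lemma LinearlyGenerated.sub {X Y : Ω → E} (hX : LinearlyGenerated V X)
    (hY : LinearlyGenerated V Y) : LinearlyGenerated V (fun ω => X ω - Y ω) := fun L => by
  simpa only [map_sub] using! V.sub_mem (hX L) (hY L)

lemma LinearlyGenerated.zero : LinearlyGenerated V (fun _ => (0 : E)) := fun L => by
  simpa only [map_zero] using! V.zero_mem

lemma LinearlyGenerated.prodMk {X : Ω → E} {Y : Ω → F} (hX : LinearlyGenerated V X)
    (hY : LinearlyGenerated V Y) : LinearlyGenerated V (fun ω => (X ω, Y ω)) := by
  have := (hX.map (.inl ℝ E F)).add (hY.map (.inr ℝ E F))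
  simpa using this

lemma LinearlyGenerated.pi {ι : Type*} [Fintype ι] {E : ι → Type*}
    [∀ i, NormedAddCommGroup (E i)] [∀ i, NormedSpace ℝ (E i)] {X : Ω → ∀ i, E i}
    (h : ∀ i, LinearlyGenerated V (fun ω => X ω i)) : LinearlyGenerated V X := fun L => by
  classical
  have : (fun ω => L (X ω)) = ∑ i, fun ω => (L ∘L (.single ℝ E i)) (X ω i) := by
    ext ω
    simp [← map_sum, LinearMap.sum_single_apply]
  rw [this]
  exact V.sum_mem fun i _ => h i _

lemma LinearlyGenerated.of_mem {X : Ω → ℝ} (h : X ∈ V) : LinearlyGenerated V X := fun L => by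
  have : (fun ω => L (X ω)) = L 1 • X := by
    ext ω
    rw [Pi.smul_apply, smul_eq_mul, mul_comm, ← smul_eq_mul, ← map_smul, smul_eq_mul, mul_one]
  rw [this]
  exact V.smul_mem _ h

lemma LinearlyGenerated.mem {X : Ω → ℝ} (h : LinearlyGenerated V X) : X ∈ V :=
  h (.id ℝ ℝ)

lemma LinearlyGenerated.eval {ι : Type*} [Fintype ι] {X : Ω → ι → ℝ}
    (h : LinearlyGenerated V X) (i : ι) : LinearlyGenerated V (fun ω => X ω i) :=
  h.map (.proj (R := ℝ) (φ := fun _ : ι => ℝ) i)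

lemma LinearlyGenerated.mulVec {a b : ℕ} (M : Matrix (Fin a) (Fin b) ℝ) {X : Ω → Fin b → ℝ}
    (h : LinearlyGenerated V X) : LinearlyGenerated V (fun ω => M *ᵥ X ω) :=
  h.map M.mulVecLin.toContinuousLinearMap

lemma LinearlyGenerated.hasGaussianLaw [MeasurableSpace Ω] {P : Measure Ω} [MeasurableSpace E]
    [BorelSpace E] {X : Ω → E} (h : LinearlyGenerated V X) (hm : AEMeasurable X P)
    (hV : ∀ Y ∈ V, HasGaussianLaw Y P) : HasGaussianLaw X P where
  isGaussian_map := isGaussian_of_isGaussian_map fun L => by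
    rw [AEMeasurable.map_map_of_aemeasurable (by fun_prop) hm]
    exact (hV _ (h L)).isGaussian_map

end LinearlyGenerated

/-! ### Cross-covariance matrices -/

section CrossCov

variable {Ω : Type*} [MeasurableSpace Ω] {a b c : ℕ}

/-- The cross-covariance matrix of two random vectors. -/
noncomputable def crossCov (P : Measure Ω) (X : Ω → Fin a → ℝ) (Y : Ω → Fin b → ℝ) :
    Matrix (Fin a) (Fin b) ℝ :=
  Matrix.of fun i j => covariance (fun ω => X ω i) (fun ω => Y ω j) P

variable {P : Measure Ω} {X X' : Ω → Fin a → ℝ} {Y : Ω → Fin b → ℝ}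

lemma crossCov_transpose : (crossCov P X Y)ᵀ = crossCov P Y X := by
  ext i j
  exact covariance_comm _ _

lemma memLp_mulVec {q : ENNReal} (M : Matrix (Fin c) (Fin a) ℝ) (hX : MemLp X q P) :
    MemLp (fun ω => M *ᵥ X ω) q P :=
  M.mulVecLin.toContinuousLinearMap.comp_memLp' hX

variable [IsProbabilityMeasure P]

lemma crossCov_mulVec_left (M : Matrix (Fin c) (Fin a) ℝ) (hX : MemLp X 2 P) (hY : MemLp Y 2 P) :
    crossCov P (fun ω => M *ᵥ X ω) Y = M * crossCov P X Y := by
  ext i j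
  simp only [crossCov, of_apply, mul_apply, mulVec, dotProduct]
  rw [covariance_fun_sum_left (fun k => (hX.eval k).const_mul _) (hY.eval j)]
  simp [covariance_const_mul_left]

lemma crossCov_mulVec_right (M : Matrix (Fin c) (Fin b) ℝ) (hX : MemLp X 2 P)
    (hY : MemLp Y 2 P) : crossCov P X (fun ω => M *ᵥ Y ω) = crossCov P X Y * Mᵀ := by
  rw [← crossCov_transpose, crossCov_mulVec_left M hY hX, transpose_mul, crossCov_transpose]

lemma crossCov_add_left (hX : MemLp X 2 P) (hX' : MemLp X' 2 P) (hY : MemLp Y 2 P) :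
    crossCov P (fun ω => X ω + X' ω) Y = crossCov P X Y + crossCov P X' Y := by
  ext i j
  exact covariance_add_left (hX.eval i) (hX'.eval i) (hY.eval j)

lemma crossCov_sub_left (hX : MemLp X 2 P) (hX' : MemLp X' 2 P) (hY : MemLp Y 2 P) :
    crossCov P (fun ω => X ω - X' ω) Y = crossCov P X Y - crossCov P X' Y := by
  ext i j
  exact covariance_sub_left (hX.eval i) (hX'.eval i) (hY.eval j)

lemma crossCov_add_right {Y' : Ω → Fin b → ℝ} (hX : MemLp X 2 P) (hY : MemLp Y 2 P)
    (hY' : MemLp Y' 2 P) :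
    crossCov P X (fun ω => Y ω + Y' ω) = crossCov P X Y + crossCov P X Y' := by
  ext i j
  exact covariance_add_right (hX.eval i) (hY.eval j) (hY'.eval j)

lemma crossCov_sub_right {Y' : Ω → Fin b → ℝ} (hX : MemLp X 2 P) (hY : MemLp Y 2 P)
    (hY' : MemLp Y' 2 P) :
    crossCov P X (fun ω => Y ω - Y' ω) = crossCov P X Y - crossCov P X Y' := by
  ext i j
  exact covariance_sub_right (hX.eval i) (hY.eval j) (hY'.eval j)

lemma posSemidef_crossCov_self (hX : MemLp X 2 P) : (crossCov P X X).PosSemidef := by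
  refine .of_dotProduct_mulVec_nonneg (by
    rw [IsHermitian, conjTranspose_eq_transpose_of_trivial, crossCov_transpose]) fun z => ?_
  have key : star z ⬝ᵥ crossCov P X X *ᵥ z = Var[fun ω => ∑ i, z i * X ω i; P] := by
    rw [← covariance_self (by
        have := fun i => (hX.eval i).aemeasurable
        fun_prop),
      covariance_fun_sum_fun_sum (fun k => (hX.eval k).const_mul _)
        (fun k => (hX.eval k).const_mul _)]
    simp only [covariance_const_mul_left, covariance_const_mul_right, dotProduct, mulVec, crossCov,
      of_apply, Finset.mul_sum, star_trivial]
    exact Finset.sum_congr rfl fun i _ => Finset.sum_congr rfl fun j _ => by ring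
  rw [key]
  exact variance_nonneg _ _

end CrossCov

/-! ### Odd moments of centred Gaussian vectors -/

/-- A centred Gaussian vector and its negative have the same law. -/
lemma HasGaussianLaw.map_neg_eq_map {Ω E : Type*} [MeasurableSpace Ω] {P : Measure Ω}
    [NormedAddCommGroup E] [NormedSpace ℝ E] [MeasurableSpace E] [BorelSpace E]
    [CompleteSpace E] [SecondCountableTopology E] {X : Ω → E} (hX : HasGaussianLaw X P)
    (h0 : ∫ ω, X ω ∂P = 0) : P.map (fun ω => -X ω) = P.map X := by
  have := hX.isProbabilityMeasure
  have h1 := hX.fun_neg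
  have := hX.isGaussian_map
  have := h1.isGaussian_map
  refine Measure.ext_of_charFunDual ?_
  ext L
  rw [h1.charFunDual_map_eq_fun, hX.charFunDual_map_eq_fun]
  have e1 : ∫ ω, L (X ω) ∂P = 0 := by
    rw [ContinuousLinearMap.integral_comp_comm _ hX.integrable, h0, map_zero]
  simp [integral_neg, e1, variance_fun_neg]

/-- Odd functions of a centred Gaussian vector have zero mean, integrable or not. -/
lemma HasGaussianLaw.integral_odd_eq_zero {Ω E F : Type*} [MeasurableSpace Ω] {P : Measure Ω}
    [NormedAddCommGroup E] [NormedSpace ℝ E] [MeasurableSpace E] [BorelSpace E]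
    [CompleteSpace E] [SecondCountableTopology E] [NormedAddCommGroup F] [NormedSpace ℝ F]
    {X : Ω → E} (hX : HasGaussianLaw X P) (h0 : ∫ ω, X ω ∂P = 0) {f : E → F}
    (hf : StronglyMeasurable f) (hodd : ∀ x, f (-x) = -f x) : ∫ ω, f (X ω) ∂P = 0 := by
  have h1 : ∫ ω, f (-X ω) ∂P = ∫ ω, f (X ω) ∂P := by
    rw [← integral_map (φ := fun ω => -X ω) hX.fun_neg.aemeasurable hf.aestronglyMeasurable,
      hX.map_neg_eq_map h0, integral_map hX.aemeasurable hf.aestronglyMeasurable]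
  simp only [hodd, integral_neg] at h1
  have h2 : (2 : ℝ) • ∫ ω, f (X ω) ∂P = 0 := by
    rw [two_smul]; nth_rw 1 [← h1]; simp
  simpa using h2

/-! ### Conditioning on independent information -/

/-- The conditional expectation of a sum of a known and an independent centred vector. -/
lemma condExp_add_of_indep {Ω : Type*} {a : ℕ} {G : MeasurableSpace Ω}
    [mΩ : MeasurableSpace Ω] {P : Measure Ω} [IsProbabilityMeasure P] (hG : G ≤ mΩ) {X Y : Ω → Fin a → ℝ}
    (hX : Measurable[G] X) (hXi : Integrable X P) (hY : Measurable Y) (hYi : Integrable Y P)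
    (hind : Indep (MeasurableSpace.comap Y inferInstance) G P) (h0 : ∫ ω, Y ω ∂P = 0) :
    condExp G P (fun ω => X ω + Y ω) =ᵐ[P] X := by
  have h1 := condExp_add hXi hYi G
  have h2 := condExp_of_stronglyMeasurable hG hX.stronglyMeasurable hXi
  have h3 := condExp_indep_eq hY.comap_le hG
    (comap_measurable Y).stronglyMeasurable hind
  filter_upwards [h1, h3] with ω h1 h3
  rw [show (fun ω => X ω + Y ω) = X + Y from rfl, h1, Pi.add_apply, h2, h3, h0, add_zero]

/-! ### Integrals of quadratic forms -/

section Quadratic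

variable {Ω : Type*} [MeasurableSpace Ω] {P : Measure Ω} {a b : ℕ}

lemma integrable_dotProduct_mulVec (M : Matrix (Fin a) (Fin b) ℝ) {X : Ω → Fin a → ℝ}
    {Y : Ω → Fin b → ℝ} (hX : MemLp X 2 P) (hY : MemLp Y 2 P) :
    Integrable (fun ω => X ω ⬝ᵥ M *ᵥ Y ω) P :=
  integrable_finsetSum _ fun i _ => (hX.eval i).integrable_mul ((memLp_mulVec M hY).eval i)

lemma integrable_dotProduct_const [IsFiniteMeasure P] (q : Fin a → ℝ) {X : Ω → Fin a → ℝ}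
    (hX : MemLp X 2 P) : Integrable (fun ω => q ⬝ᵥ X ω) P :=
  integrable_finsetSum _ fun i _ => ((hX.eval i).integrable (by norm_num)).const_mul _

variable [IsProbabilityMeasure P]

lemma integral_dotProduct_mulVec_of_indep (M : Matrix (Fin a) (Fin b) ℝ) {X : Ω → Fin a → ℝ}
    {Y : Ω → Fin b → ℝ} (hX : MemLp X 2 P) (hY : MemLp Y 2 P) (hXY : IndepFun X Y P)
    (h0 : ∫ ω, Y ω ∂P = 0) : ∫ ω, X ω ⬝ᵥ M *ᵥ Y ω ∂P = 0 := by
  have hMY := memLp_mulVec M hY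
  have hM0 (i : Fin a) : ∫ ω, (M *ᵥ Y ω) i ∂P = 0 := by
    rw [← eval_integral fun i => (hMY.eval i).integrable (by norm_num)]
    have := M.mulVecLin.toContinuousLinearMap.integral_comp_comm (hY.integrable (by norm_num))
    rw [h0, map_zero] at this
    exact congrFun this i
  simp only [dotProduct]
  refine (integral_finsetSum _ fun i _ => (hX.eval i).integrable_mul (hMY.eval i)).trans ?_
  refine Finset.sum_eq_zero fun i _ => ?_
  have hind : IndepFun (fun ω => X ω i) (fun ω => (M *ᵥ Y ω) i) P :=
    IndepFun.comp (φ := fun x : Fin a → ℝ => x i) (ψ := fun y : Fin b → ℝ => (M *ᵥ y) i) hXY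
      (by fun_prop) (by fun_prop)
  refine Eq.trans ?_ (mul_zero (∫ ω, X ω i ∂P))
  rw [← hM0 i, ← hind.integral_fun_mul_eq_mul_integral (hX.eval i).aestronglyMeasurable
    (hMY.eval i).aestronglyMeasurable]
  rfl

lemma integral_quadratic_add_of_indep (M : Matrix (Fin a) (Fin a) ℝ) {X Y : Ω → Fin a → ℝ}
    (hX : MemLp X 2 P) (hY : MemLp Y 2 P) (hXY : IndepFun X Y P) (h0 : ∫ ω, Y ω ∂P = 0) :
    ∫ ω, (X ω + Y ω) ⬝ᵥ M *ᵥ (X ω + Y ω) ∂P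
      = ∫ ω, X ω ⬝ᵥ M *ᵥ X ω ∂P + ∫ ω, Y ω ⬝ᵥ M *ᵥ Y ω ∂P := by
  have h1 (ω : Ω) : (X ω + Y ω) ⬝ᵥ M *ᵥ (X ω + Y ω) = (X ω ⬝ᵥ M *ᵥ X ω + Y ω ⬝ᵥ M *ᵥ Y ω)
      + (X ω ⬝ᵥ M *ᵥ Y ω + X ω ⬝ᵥ Mᵀ *ᵥ Y ω) := by
    have : X ω ⬝ᵥ Mᵀ *ᵥ Y ω = Y ω ⬝ᵥ M *ᵥ X ω := by
      rw [mulVec_transpose, dotProduct_comm, ← dotProduct_mulVec]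
    rw [this, mulVec_add, dotProduct_add, add_dotProduct, add_dotProduct]
    ring
  simp only [h1]
  refine (integral_add ((integrable_dotProduct_mulVec M hX hX).add
      (integrable_dotProduct_mulVec M hY hY))
      ((integrable_dotProduct_mulVec M hX hY).add (integrable_dotProduct_mulVec Mᵀ hX hY))).trans ?_
  simp only [Pi.add_apply]
  rw [integral_add (integrable_dotProduct_mulVec M hX hX) (integrable_dotProduct_mulVec M hY hY),
    integral_add (integrable_dotProduct_mulVec M hX hY) (integrable_dotProduct_mulVec Mᵀ hX hY),
    integral_dotProduct_mulVec_of_indep M hX hY hXY h0,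
    integral_dotProduct_mulVec_of_indep Mᵀ hX hY hXY h0, add_zero, add_zero]

lemma integral_dotProduct_add (q : Fin a → ℝ) {X Y : Ω → Fin a → ℝ}
    (hX : MemLp X 2 P) (hY : MemLp Y 2 P) (h0 : ∫ ω, Y ω ∂P = 0) :
    ∫ ω, q ⬝ᵥ (X ω + Y ω) ∂P = ∫ ω, q ⬝ᵥ X ω ∂P := by
  have hq : ∫ ω, q ⬝ᵥ Y ω ∂P = 0 := by
    simp only [dotProduct]
    rw [integral_finsetSum _ fun i _ => ((hY.eval i).integrable (by norm_num)).const_mul _]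
    refine Finset.sum_eq_zero fun i _ => ?_
    rw [integral_const_mul, ← eval_integral fun i => (hY.eval i).integrable (by norm_num), h0]
    simp
  simp only [dotProduct_add]
  rw [integral_add (integrable_dotProduct_const q hX) (integrable_dotProduct_const q hY), hq,
    add_zero]

end Quadratic

end ProbabilityTheory

namespace LQProblem

variable {n m p : ℕ} {Ω : Type*}

/-! ### The centred noise and the filtering error -/

/-- The linear span of the coordinates of the centred noise vectors `w_k - wbar`, `v_k`
with `k ≤ t`. -/
def noiseSpan (D : LQProblem n m p Ω) (wbar : Fin n → ℝ) (t : ℕ) : Submodule ℝ (Ω → ℝ) :=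
  Submodule.span ℝ ({X | ∃ k ≤ t, ∃ i, X = fun ω => D.w k ω i - wbar i} ∪
    {X | ∃ k ≤ t, ∃ j, X = fun ω => D.v k ω j})

/-- The error `e_t` of the Kalman predictor, `e_0 = 0` and
`e_{t+1} = A (e_t - L_t (C e_t + v_t)) + (w_{t+1} - wbar)` with the filter gain `L_t`. It is
driven by the noise alone and involves no control. -/
noncomputable def filterError (D : LQProblem n m p Ω) (wbar : Fin n → ℝ)
    (W : Matrix (Fin n) (Fin n) ℝ) (S : Matrix (Fin m) (Fin m) ℝ) : ℕ → Ω → Fin n → ℝ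
  | 0 => fun _ => 0
  | t + 1 => fun ω => D.A *ᵥ (D.filterError wbar W S t ω
      - D.kalmanGain W S t *ᵥ (D.C *ᵥ D.filterError wbar W S t ω + D.v t ω))
      + (D.w (t + 1) ω - wbar)

/-- The output residual `C e_t + v_t`, that is, the part of `y_t` that the Kalman predictor does
not foresee. -/
noncomputable def residual (D : LQProblem n m p Ω) (wbar : Fin n → ℝ)
    (W : Matrix (Fin n) (Fin n) ℝ) (S : Matrix (Fin m) (Fin m) ℝ) (t : ℕ) (ω : Ω) : Fin m → ℝ :=
  D.C *ᵥ D.filterError wbar W S t ω + D.v t ω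

/-- The σ-algebra generated by the `t` output residuals at times `0, …, t - 1`. -/
@[reducible] noncomputable def residualInfo (D : LQProblem n m p Ω) (wbar : Fin n → ℝ)
    (W : Matrix (Fin n) (Fin n) ℝ) (S : Matrix (Fin m) (Fin m) ℝ) (t : ℕ) : MeasurableSpace Ω :=
  MeasurableSpace.comap (fun ω (q : Fin t × Fin m) => D.residual wbar W S q.1 ω q.2) inferInstance

lemma filterError_succ (D : LQProblem n m p Ω) (wbar : Fin n → ℝ) (W : Matrix (Fin n) (Fin n) ℝ)
    (S : Matrix (Fin m) (Fin m) ℝ) (t : ℕ) :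
    D.filterError wbar W S (t + 1) = fun ω => D.A *ᵥ (D.filterError wbar W S t ω
      - D.kalmanGain W S t *ᵥ D.residual wbar W S t ω) + (D.w (t + 1) ω - wbar) := rfl

lemma kalmanCov_succ (D : LQProblem n m p Ω) (W : Matrix (Fin n) (Fin n) ℝ)
    (S : Matrix (Fin m) (Fin m) ℝ) (t : ℕ) :
    D.kalmanCov W S (t + 1) = D.A * (D.kalmanCov W S t
      - D.kalmanGain W S t * (D.C * D.kalmanCov W S t)) * D.Aᵀ + W := by
  rw [kalmanCov, kalmanGain]
  simp only [Matrix.mul_sub, Matrix.sub_mul, Matrix.mul_assoc]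
  abel

/-- The error left after the correction by the current residual. -/
noncomputable def correctedError (D : LQProblem n m p Ω) (wbar : Fin n → ℝ)
    (W : Matrix (Fin n) (Fin n) ℝ) (S : Matrix (Fin m) (Fin m) ℝ) (t : ℕ) (ω : Ω) : Fin n → ℝ :=
  D.filterError wbar W S t ω - D.kalmanGain W S t *ᵥ D.residual wbar W S t ω

section Linear

variable (D : LQProblem n m p Ω) {wbar : Fin n → ℝ} {W : Matrix (Fin n) (Fin n) ℝ}
  {S : Matrix (Fin m) (Fin m) ℝ}

lemma linearlyGenerated_w {k t : ℕ} (h : k ≤ t) :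
    LinearlyGenerated (D.noiseSpan wbar t) (fun ω => D.w k ω - wbar) :=
  .pi fun i => .of_mem (Submodule.subset_span (.inl ⟨k, h, i, rfl⟩))

lemma linearlyGenerated_v {k t : ℕ} (h : k ≤ t) :
    LinearlyGenerated (D.noiseSpan wbar t) (D.v k) :=
  .pi fun i => .of_mem (Submodule.subset_span (.inr ⟨k, h, i, rfl⟩))

lemma linearlyGenerated_filterError {s t : ℕ} (h : s ≤ t) :
    LinearlyGenerated (D.noiseSpan wbar t) (D.filterError wbar W S s) := by
  induction s with
  | zero => exact .zero
  | succ s ih =>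
    have h1 := ih (by omega)
    exact ((h1.sub (((h1.mulVec D.C).add (D.linearlyGenerated_v (by omega))).mulVec _)).mulVec
      D.A).add (D.linearlyGenerated_w h)

lemma linearlyGenerated_residual {s t : ℕ} (h : s ≤ t) :
    LinearlyGenerated (D.noiseSpan wbar t) (D.residual wbar W S s) :=
  ((D.linearlyGenerated_filterError h).mulVec D.C).add (D.linearlyGenerated_v h)

lemma linearlyGenerated_correctedError (t : ℕ) :
    LinearlyGenerated (D.noiseSpan wbar t) (D.correctedError wbar W S t) :=
  (D.linearlyGenerated_filterError le_rfl).sub ((D.linearlyGenerated_residual le_rfl).mulVec _)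

/-- The normal equation satisfied by the filter gain. At time `0` both sides vanish, so that no
invertibility is needed there. -/
lemma kalmanGain_mul {T t : ℕ}
    (hinv : ∀ t, 1 ≤ t → t < T → IsUnit (D.C * D.kalmanCov W S t * D.Cᵀ + S).det) (ht : t < T) :
    D.kalmanGain W S t * (D.C * D.kalmanCov W S t * D.Cᵀ + S) = D.kalmanCov W S t * D.Cᵀ := by
  rcases Nat.eq_zero_or_pos t with rfl | h0
  · simp [kalmanGain, kalmanCov]
  · rw [kalmanGain, Matrix.nonsing_inv_mul_cancel_right _ _ (hinv t h0 ht)]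

end Linear

section Noise

variable [MeasurableSpace Ω] {P : Measure Ω} {D : LQProblem n m p Ω} {wbar : Fin n → ℝ}
  {W : Matrix (Fin n) (Fin n) ℝ} {S : Matrix (Fin m) (Fin m) ℝ}

lemma hasGaussianLaw_of_mem_noiseSpan (hnoise : IsGaussianNoise P D.w D.v wbar W S) {t : ℕ}
    {Y : Ω → ℝ} (hY : Y ∈ D.noiseSpan wbar t) : HasGaussianLaw Y P := by
  have hζ : HasGaussianLaw (fun ω (k : Fin (t + 1)) => (D.w k ω, D.v k ω)) P :=
    (hnoise.indep.precomp Fin.val_injective).hasGaussianLaw fun k => hnoise.gaussian k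
  -- Every element of the span is an affine function of the jointly Gaussian vector above.
  obtain ⟨L, c, rfl⟩ : ∃ (L : StrongDual ℝ (Fin (t + 1) → (Fin n → ℝ) × (Fin m → ℝ))) (c : ℝ),
      Y = fun ω => L (fun k : Fin (t + 1) => (D.w k ω, D.v k ω)) + c := by
    induction hY using Submodule.span_induction with
    | mem X hX =>
      rcases hX with ⟨k, hk, i, rfl⟩ | ⟨k, hk, i, rfl⟩
      · exact ⟨.proj (R := ℝ) (φ := fun _ : Fin n => ℝ) i ∘L .fst ℝ _ _ ∘L
          .proj (R := ℝ) (φ := fun _ => (Fin n → ℝ) × (Fin m → ℝ)) ⟨k, by omega⟩, -wbar i, rfl⟩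
      · exact ⟨.proj (R := ℝ) (φ := fun _ : Fin m => ℝ) i ∘L .snd ℝ _ _ ∘L
          .proj (R := ℝ) (φ := fun _ => (Fin n → ℝ) × (Fin m → ℝ)) ⟨k, by omega⟩, 0, by simp⟩
    | zero => exact ⟨0, 0, by ext; simp⟩
    | add X Y _ _ hX hY =>
      obtain ⟨L, c, rfl⟩ := hX
      obtain ⟨L', c', rfl⟩ := hY
      exact ⟨L + L', c + c', by ext; simp; ring⟩
    | smul a X _ hX =>
      obtain ⟨L, c, rfl⟩ := hX
      exact ⟨a • L, a * c, by ext; simp; ring⟩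
  have h1 := hζ.map_fun L
  have := h1.isGaussian_map
  have h2 : P.map (fun ω => L (fun k : Fin (t + 1) => (D.w k ω, D.v k ω)) + c)
      = (P.map (fun ω => L (fun k : Fin (t + 1) => (D.w k ω, D.v k ω)))).map (· + c) := by
    rw [AEMeasurable.map_map_of_aemeasurable (by fun_prop) h1.aemeasurable]
    rfl
  exact ⟨h2 ▸ inferInstance⟩

lemma integral_eq_zero_of_mem_noiseSpan [IsProbabilityMeasure P]
    (hnoise : IsGaussianNoise P D.w D.v wbar W S) {t : ℕ}
    {Y : Ω → ℝ} (hY : Y ∈ D.noiseSpan wbar t) : ∫ ω, Y ω ∂P = 0 := by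
  induction hY using Submodule.span_induction with
  | mem X hX =>
    rcases hX with ⟨k, hk, i, rfl⟩ | ⟨k, hk, i, rfl⟩
    · rw [integral_sub ((hnoise.gaussian k).fst.integrable.eval i) (integrable_const _),
        hnoise.mean_w]
      simp
    · exact hnoise.mean_v k i
  | zero => simp
  | add X Y hX' hY' hX hY =>
    simp only [Pi.add_apply]
    rw [integral_add (hasGaussianLaw_of_mem_noiseSpan hnoise hX').integrable
      (hasGaussianLaw_of_mem_noiseSpan hnoise hY').integrable, hX, hY, add_zero]
  | smul a X hX' hX => simp [integral_const_mul, hX]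

lemma covariance_eq_zero_of_mem_noiseSpan [IsProbabilityMeasure P]
    (hnoise : IsGaussianNoise P D.w D.v wbar W S) {t k : ℕ} (hk : t < k)
    {Y : Ω → ℝ} (hY : Y ∈ D.noiseSpan wbar t) (L : StrongDual ℝ ((Fin n → ℝ) × (Fin m → ℝ))) :
    covariance Y (fun ω => L (D.w k ω, D.v k ω)) P = 0 := by
  have hL := ((hnoise.gaussian k).map_fun L).memLp_two
  induction hY using Submodule.span_induction with
  | mem X hX =>
    have aux (l : ℕ) (hl : l ≤ t) (L' : StrongDual ℝ ((Fin n → ℝ) × (Fin m → ℝ))) :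
        covariance (fun ω => L' (D.w l ω, D.v l ω)) (fun ω => L (D.w k ω, D.v k ω)) P = 0 :=
      ((hnoise.indep.indepFun (show l ≠ k by omega)).comp
        L'.measurable L.measurable).covariance_eq_zero
        ((hnoise.gaussian l).map_fun L').memLp_two hL
    rcases hX with ⟨l, hl, i, rfl⟩ | ⟨l, hl, i, rfl⟩
    · refine (covariance_sub_const_left ((hnoise.gaussian l).fst.integrable.eval i) (wbar i)).trans ?_
      exact aux l hl (.proj (R := ℝ) (φ := fun _ : Fin n => ℝ) i ∘L .fst ℝ _ _)
    · exact aux l hl (.proj (R := ℝ) (φ := fun _ : Fin m => ℝ) i ∘L .snd ℝ _ _)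
  | zero => exact covariance_zero_left
  | add X Y hX' hY' hX hY =>
    rw [covariance_add_left (hasGaussianLaw_of_mem_noiseSpan hnoise hX').memLp_two
      (hasGaussianLaw_of_mem_noiseSpan hnoise hY').memLp_two hL, hX, hY, add_zero]
  | smul a X hX' hX => rw [covariance_smul_left, hX, mul_zero]

lemma measurable_filterError (hnoise : IsGaussianNoise P D.w D.v wbar W S) (t : ℕ) :
    Measurable (D.filterError wbar W S t) := by
  induction t with
  | zero => exact measurable_const
  | succ t ih =>
    have := hnoise.measurable_v t
    have := hnoise.measurable_w (t + 1)
    rw [filterError_succ]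
    unfold residual
    fun_prop

lemma measurable_residual (hnoise : IsGaussianNoise P D.w D.v wbar W S) (t : ℕ) :
    Measurable (D.residual wbar W S t) := by
  have := hnoise.measurable_v t
  have := measurable_filterError hnoise t
  unfold residual
  fun_prop

lemma hasGaussianLaw_filterError (hnoise : IsGaussianNoise P D.w D.v wbar W S) (t : ℕ) :
    HasGaussianLaw (D.filterError wbar W S t) P :=
  (D.linearlyGenerated_filterError le_rfl).hasGaussianLaw
    (measurable_filterError hnoise t).aemeasurable fun _ => hasGaussianLaw_of_mem_noiseSpan hnoise

lemma hasGaussianLaw_residual (hnoise : IsGaussianNoise P D.w D.v wbar W S) (t : ℕ) :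
    HasGaussianLaw (D.residual wbar W S t) P :=
  (D.linearlyGenerated_residual le_rfl).hasGaussianLaw
    (measurable_residual hnoise t).aemeasurable fun _ => hasGaussianLaw_of_mem_noiseSpan hnoise

lemma hasGaussianLaw_filterError_pi (hnoise : IsGaussianNoise P D.w D.v wbar W S) (T : ℕ) :
    HasGaussianLaw (fun ω (t : Fin (T + 1)) => D.filterError wbar W S t ω) P :=
  (LinearlyGenerated.pi fun i : Fin (T + 1) =>
      D.linearlyGenerated_filterError (by omega)).hasGaussianLaw
    (measurable_pi_lambda _ fun t : Fin (T + 1) => measurable_filterError hnoise t).aemeasurable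
    fun _ => hasGaussianLaw_of_mem_noiseSpan (t := T) hnoise

lemma integral_eq_zero_of_linearlyGenerated [IsProbabilityMeasure P]
    (hnoise : IsGaussianNoise P D.w D.v wbar W S) {t a : ℕ} {X : Ω → Fin a → ℝ}
    (hX : LinearlyGenerated (D.noiseSpan wbar t) X) : ∫ ω, X ω ∂P = 0 := by
  have h := fun i => (hX.eval i).mem
  ext i
  rw [eval_integral fun i => (hasGaussianLaw_of_mem_noiseSpan hnoise (h i)).integrable]
  exact integral_eq_zero_of_mem_noiseSpan hnoise (h i)

/-! ### Orthogonality of the residuals and the Kalman covariance recursion -/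

lemma crossCov_v_eq_zero [IsProbabilityMeasure P] (hnoise : IsGaussianNoise P D.w D.v wbar W S)
    {t k a : ℕ} (hk : t < k) {X : Ω → Fin a → ℝ} (hX : LinearlyGenerated (D.noiseSpan wbar t) X) :
    crossCov P X (D.v k) = 0 := by
  ext i j
  exact covariance_eq_zero_of_mem_noiseSpan hnoise hk (hX.eval i).mem
    (.proj (R := ℝ) (φ := fun _ : Fin m => ℝ) j ∘L .snd ℝ _ _)

lemma memLp_w_sub [IsProbabilityMeasure P] (hnoise : IsGaussianNoise P D.w D.v wbar W S)
    (k : ℕ) : MemLp (fun ω => D.w k ω - wbar) 2 P :=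
  (hnoise.gaussian k).fst.memLp_two.sub (memLp_const _)

lemma crossCov_w_eq_zero [IsProbabilityMeasure P] (hnoise : IsGaussianNoise P D.w D.v wbar W S)
    {t k a : ℕ} (hk : t < k) {X : Ω → Fin a → ℝ} (hX : LinearlyGenerated (D.noiseSpan wbar t) X) :
    crossCov P X (fun ω => D.w k ω - wbar) = 0 := by
  ext i j
  refine (covariance_sub_const_right ((hnoise.gaussian k).fst.integrable.eval j) (wbar j)).trans ?_
  exact covariance_eq_zero_of_mem_noiseSpan hnoise hk (hX.eval i).mem
    (.proj (R := ℝ) (φ := fun _ : Fin n => ℝ) j ∘L .fst ℝ _ _)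

lemma crossCov_w_self [IsProbabilityMeasure P] (hnoise : IsGaussianNoise P D.w D.v wbar W S)
    (k : ℕ) : crossCov P (fun ω => D.w k ω - wbar) (fun ω => D.w k ω - wbar) = W := by
  have h := (hnoise.gaussian k).fst.integrable
  ext i j
  refine (covariance_sub_const_left (h.eval i) (wbar i)).trans ?_
  refine (covariance_sub_const_right (h.eval j) (wbar j)).trans ?_
  exact hnoise.cov_w k i j

lemma crossCov_w_v [IsProbabilityMeasure P] (hnoise : IsGaussianNoise P D.w D.v wbar W S)
    (k : ℕ) : crossCov P (fun ω => D.w k ω - wbar) (D.v k) = 0 := by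
  ext i j
  refine (covariance_sub_const_left ((hnoise.gaussian k).fst.integrable.eval i) (wbar i)).trans ?_
  exact hnoise.cov_wv k i j

lemma crossCov_v_self (hnoise : IsGaussianNoise P D.w D.v wbar W S) (k : ℕ) :
    crossCov P (D.v k) (D.v k) = S := by
  ext i j
  exact hnoise.cov_v k i j

lemma crossCov_filterError_v [IsProbabilityMeasure P]
    (hnoise : IsGaussianNoise P D.w D.v wbar W S) (t : ℕ) :
    crossCov P (D.filterError wbar W S t) (D.v t) = 0 := by
  cases t with
  | zero =>
    ext i j
    exact covariance_zero_left
  | succ t =>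
    have h1 : LinearlyGenerated (D.noiseSpan wbar t) (fun ω => D.A *ᵥ (D.filterError wbar W S t ω
      - D.kalmanGain W S t *ᵥ D.residual wbar W S t ω)) :=
      ((D.linearlyGenerated_filterError le_rfl).sub
        ((D.linearlyGenerated_residual le_rfl).mulVec _)).mulVec _
    have h2 : MemLp (fun ω => D.A *ᵥ (D.filterError wbar W S t ω
      - D.kalmanGain W S t *ᵥ D.residual wbar W S t ω)) 2 P :=
      memLp_mulVec _ ((hasGaussianLaw_filterError hnoise t).memLp_two.sub
        (memLp_mulVec _ (hasGaussianLaw_residual hnoise t).memLp_two))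
    rw [filterError_succ, crossCov_add_left h2 (memLp_w_sub hnoise _)
      (hnoise.gaussian _).snd.memLp_two, crossCov_v_eq_zero hnoise (Nat.lt_succ_self t) h1,
      crossCov_w_v hnoise, add_zero]

lemma memLp_correctedError (hnoise : IsGaussianNoise P D.w D.v wbar W S) (t : ℕ) :
    MemLp (D.correctedError wbar W S t) 2 P :=
  (hasGaussianLaw_filterError hnoise t).memLp_two.sub
    (memLp_mulVec _ (hasGaussianLaw_residual hnoise t).memLp_two)

/-- One step of the Kalman filter: if the error at time `t` has covariance `W_t` and is uncorrelated
with the earlier residuals, then so is the corrected error, also with the current residual, and the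
error at time `t + 1` has covariance `W_{t+1}`. -/
lemma crossCov_step [IsProbabilityMeasure P] (hnoise : IsGaussianNoise P D.w D.v wbar W S)
    {T t : ℕ}
    (hinv : ∀ t, 1 ≤ t → t < T → IsUnit (D.C * D.kalmanCov W S t * D.Cᵀ + S).det) (ht : t < T)
    (hcov : crossCov P (D.filterError wbar W S t) (D.filterError wbar W S t) = D.kalmanCov W S t)
    (horth : ∀ s < t, crossCov P (D.filterError wbar W S t) (D.residual wbar W S s) = 0) :
    (∀ s < t, crossCov P (D.residual wbar W S t) (D.residual wbar W S s) = 0) ∧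
    (∀ s < t + 1, crossCov P (D.correctedError wbar W S t) (D.residual wbar W S s) = 0) ∧
    crossCov P (D.filterError wbar W S (t + 1)) (D.filterError wbar W S (t + 1))
      = D.kalmanCov W S (t + 1) := by
  set L := D.kalmanGain W S t with hL
  have he := (hasGaussianLaw_filterError hnoise t).memLp_two
  have hν := fun s => (hasGaussianLaw_residual hnoise s).memLp_two
  have hv := (hnoise.gaussian t).snd.memLp_two
  have hw := memLp_w_sub hnoise (t + 1)
  have hr := memLp_correctedError hnoise t
  have hC := memLp_mulVec D.C he
  have hLν := memLp_mulVec L (hν t)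
  have hsym : (D.kalmanCov W S t)ᵀ = D.kalmanCov W S t := by rw [← hcov, crossCov_transpose]
  have c1 : ∀ s < t, crossCov P (D.residual wbar W S t) (D.residual wbar W S s) = 0 := by
    intro s hs
    have h0 : crossCov P (D.v t) (D.residual wbar W S s) = 0 := by
      rw [← crossCov_transpose, crossCov_v_eq_zero hnoise hs (D.linearlyGenerated_residual le_rfl),
        transpose_zero]
    rw [show D.residual wbar W S t = fun ω => D.C *ᵥ D.filterError wbar W S t ω + D.v t ω from rfl,
      crossCov_add_left hC hv (hν s), crossCov_mulVec_left _ he (hν s), horth s hs, h0]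
    simp
  have c2 : crossCov P (D.filterError wbar W S t) (D.residual wbar W S t)
      = D.kalmanCov W S t * D.Cᵀ := by
    rw [show D.residual wbar W S t = fun ω => D.C *ᵥ D.filterError wbar W S t ω + D.v t ω from rfl,
      crossCov_add_right he hC hv, crossCov_mulVec_right _ he he, hcov,
      crossCov_filterError_v hnoise, add_zero]
  have c2' : crossCov P (D.residual wbar W S t) (D.filterError wbar W S t)
      = D.C * D.kalmanCov W S t := by
    rw [← crossCov_transpose, c2, transpose_mul, transpose_transpose, hsym]
  have c3 : crossCov P (D.residual wbar W S t) (D.residual wbar W S t)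
      = D.C * D.kalmanCov W S t * D.Cᵀ + S := by
    have h0 : crossCov P (D.v t) (D.residual wbar W S t) = S := by
      rw [show D.residual wbar W S t = fun ω => D.C *ᵥ D.filterError wbar W S t ω + D.v t ω from
        rfl, crossCov_add_right hv hC hv, crossCov_mulVec_right _ hv he, crossCov_v_self hnoise,
        ← crossCov_transpose, crossCov_filterError_v hnoise]
      simp
    have : crossCov P (D.residual wbar W S t) (D.residual wbar W S t)
        = D.C * crossCov P (D.filterError wbar W S t) (D.residual wbar W S t)
          + crossCov P (D.v t) (D.residual wbar W S t) := by
      rw [← crossCov_mulVec_left _ he (hν t), ← crossCov_add_left hC hv (hν t)]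
      rfl
    rw [this, c2, h0, Matrix.mul_assoc]
  have c4 : ∀ s < t + 1, crossCov P (D.correctedError wbar W S t) (D.residual wbar W S s) = 0 := by
    intro s hs
    have : crossCov P (D.correctedError wbar W S t) (D.residual wbar W S s)
        = crossCov P (D.filterError wbar W S t) (D.residual wbar W S s)
          - L * crossCov P (D.residual wbar W S t) (D.residual wbar W S s) := by
      rw [← crossCov_mulVec_left _ (hν t) (hν s), ← crossCov_sub_left he hLν (hν s)]
      rfl
    rw [this]
    rcases Nat.lt_succ_iff_lt_or_eq.mp hs with h | rfl
    · rw [horth s h, c1 s h]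
      simp
    · rw [c2, c3, hL, D.kalmanGain_mul hinv ht, sub_self]
  refine ⟨c1, c4, ?_⟩
  have c5 : crossCov P (D.correctedError wbar W S t) (D.correctedError wbar W S t)
      = D.kalmanCov W S t - L * (D.C * D.kalmanCov W S t) := by
    have h1 : crossCov P (D.correctedError wbar W S t) (D.correctedError wbar W S t)
        = crossCov P (D.correctedError wbar W S t) (D.filterError wbar W S t)
          - crossCov P (D.correctedError wbar W S t) (D.residual wbar W S t) * Lᵀ := by
      rw [← crossCov_mulVec_right _ hr (hν t), ← crossCov_sub_right hr he hLν]
      rfl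
    have h2 : crossCov P (D.correctedError wbar W S t) (D.filterError wbar W S t)
        = crossCov P (D.filterError wbar W S t) (D.filterError wbar W S t)
          - L * crossCov P (D.residual wbar W S t) (D.filterError wbar W S t) := by
      rw [← crossCov_mulVec_left _ (hν t) he, ← crossCov_sub_left he hLν he]
      rfl
    rw [h1, c4 t (Nat.lt_succ_self t), h2, hcov, c2']
    simp
  have h6 := crossCov_w_eq_zero hnoise (show t < t + 1 by omega)
    ((D.linearlyGenerated_correctedError (wbar := wbar) (W := W) (S := S) t).mulVec D.A)
  have h7 : D.filterError wbar W S (t + 1)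
      = fun ω => D.A *ᵥ D.correctedError wbar W S t ω + (D.w (t + 1) ω - wbar) := rfl
  have hAr := memLp_mulVec D.A hr
  have hAw : MemLp (fun ω => D.A *ᵥ D.correctedError wbar W S t ω + (D.w (t + 1) ω - wbar)) 2 P :=
    hAr.add hw
  rw [h7, crossCov_add_left hAr hw hAw, crossCov_add_right hAr hAr hw,
    crossCov_add_right hw hAr hw, h6, ← crossCov_transpose (X := fun ω =>
      D.A *ᵥ D.correctedError wbar W S t ω) (Y := fun ω => D.w (t + 1) ω - wbar), h6, crossCov_w_self hnoise,
    crossCov_mulVec_left _ hr hAr, crossCov_mulVec_right _ hr hr, c5, kalmanCov_succ, ← hL]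
  simp [Matrix.mul_assoc]

/-- The error of the Kalman predictor has covariance `W_t` and is uncorrelated with the earlier
residuals. -/
lemma crossCov_filterError [IsProbabilityMeasure P] (hnoise : IsGaussianNoise P D.w D.v wbar W S)
    {T t : ℕ}
    (hinv : ∀ t, 1 ≤ t → t < T → IsUnit (D.C * D.kalmanCov W S t * D.Cᵀ + S).det) (ht : t ≤ T) :
    crossCov P (D.filterError wbar W S t) (D.filterError wbar W S t) = D.kalmanCov W S t ∧
    ∀ s < t, crossCov P (D.filterError wbar W S t) (D.residual wbar W S s) = 0 := by
  induction t with
  | zero =>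
    refine ⟨?_, fun s hs => absurd hs (Nat.not_lt_zero s)⟩
    ext i j
    exact covariance_zero_left
  | succ t ih =>
    obtain ⟨h1, h2⟩ := ih (by omega)
    obtain ⟨-, h3, h4⟩ := crossCov_step hnoise hinv ht h1 h2
    refine ⟨h4, fun s hs => ?_⟩
    have hr := memLp_correctedError hnoise t
    have hν := (hasGaussianLaw_residual hnoise s).memLp_two
    have h5 : crossCov P (fun ω => D.w (t + 1) ω - wbar) (D.residual wbar W S s) = 0 := by
      rw [← crossCov_transpose, crossCov_w_eq_zero hnoise hs (D.linearlyGenerated_residual le_rfl),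
        transpose_zero]
    rw [show D.filterError wbar W S (t + 1) = fun ω => D.A *ᵥ D.correctedError wbar W S t ω
      + (D.w (t + 1) ω - wbar) from rfl, crossCov_add_left (memLp_mulVec _ hr)
      (memLp_w_sub hnoise _) hν, crossCov_mulVec_left _ hr hν, h3 s hs, h5]
    simp

/-- Uncorrelated and jointly Gaussian vectors are independent: a vector generated by the noise that
is uncorrelated with the first `t` residuals is independent of the information they carry. -/
lemma indep_residualInfo [IsProbabilityMeasure P] (hnoise : IsGaussianNoise P D.w D.v wbar W S)
    {T t a : ℕ} {X : Ω → Fin a → ℝ} (hX : LinearlyGenerated (D.noiseSpan wbar T) X)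
    (hXm : Measurable X) (htT : t ≤ T + 1)
    (h : ∀ s < t, crossCov P X (D.residual wbar W S s) = 0) :
    IndepFun X (fun ω (q : Fin t × Fin m) => D.residual wbar W S q.1 ω q.2) P := by
  have hm : Measurable (fun ω (q : Fin t × Fin m) => D.residual wbar W S q.1 ω q.2) :=
    measurable_pi_lambda _ fun q => (measurable_pi_apply q.2).comp (measurable_residual hnoise q.1)
  have hlin : LinearlyGenerated (D.noiseSpan wbar T)
      (fun ω (q : Fin t × Fin m) => D.residual wbar W S q.1 ω q.2) :=
    .pi fun q => (D.linearlyGenerated_residual (by omega)).eval q.2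
  exact ((hX.prodMk hlin).hasGaussianLaw (hXm.prodMk hm).aemeasurable
    fun _ => hasGaussianLaw_of_mem_noiseSpan hnoise).indepFun_of_covariance_eval
    (X := fun i ω => X ω i) (Y := fun (q : Fin t × Fin m) ω => D.residual wbar W S q.1 ω q.2)
    fun i q => congrFun (congrFun (h q.1 q.1.2) i) q.2

end Noise

/-! ### The Kalman predictor and the information it uses -/

/-- The Kalman predictor under the control `u`, driven by the output residuals. -/
noncomputable def predictor (D : LQProblem n m p Ω) (wbar : Fin n → ℝ)
    (W : Matrix (Fin n) (Fin n) ℝ) (S : Matrix (Fin m) (Fin m) ℝ) (u : ℕ → Ω → Fin p → ℝ) :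
    ℕ → Ω → Fin n → ℝ
  | 0 => fun _ => D.x0
  | t + 1 => fun ω => D.A *ᵥ (D.predictor wbar W S u t ω
      + D.kalmanGain W S t *ᵥ D.residual wbar W S t ω) + D.B *ᵥ u t ω + wbar

/-- The Kalman filter: the predictor corrected by the current residual. -/
noncomputable def corrector (D : LQProblem n m p Ω) (wbar : Fin n → ℝ)
    (W : Matrix (Fin n) (Fin n) ℝ) (S : Matrix (Fin m) (Fin m) ℝ) (u : ℕ → Ω → Fin p → ℝ)
    (t : ℕ) (ω : Ω) : Fin n → ℝ :=
  D.predictor wbar W S u t ω + D.kalmanGain W S t *ᵥ D.residual wbar W S t ω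

section Pathwise

variable (D : LQProblem n m p Ω) (wbar : Fin n → ℝ) (W : Matrix (Fin n) (Fin n) ℝ)
  (S : Matrix (Fin m) (Fin m) ℝ) (u : ℕ → Ω → Fin p → ℝ)

lemma predictor_succ (t : ℕ) : D.predictor wbar W S u (t + 1)
    = fun ω => D.A *ᵥ D.corrector wbar W S u t ω + D.B *ᵥ u t ω + wbar := rfl

lemma state_eq_add (t : ℕ) (ω : Ω) :
    D.state u t ω = D.predictor wbar W S u t ω + D.filterError wbar W S t ω := by
  induction t with
  | zero => simp [state, predictor, filterError]
  | succ t ih =>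
    rw [show D.state u (t + 1) ω = D.A *ᵥ D.state u t ω + D.B *ᵥ u t ω + D.w (t + 1) ω from rfl,
      ih, predictor_succ, filterError_succ]
    simp only [corrector]
    simp only [mulVec_add, mulVec_sub]
    abel

lemma state_eq_corrector_add (t : ℕ) (ω : Ω) :
    D.state u t ω = D.corrector wbar W S u t ω + D.correctedError wbar W S t ω := by
  rw [state_eq_add D wbar W S, corrector, correctedError]
  abel

lemma output_eq_add (t : ℕ) (ω : Ω) :
    D.output u t ω = D.C *ᵥ D.predictor wbar W S u t ω + D.residual wbar W S t ω := by
  rw [output, state_eq_add D wbar W S, residual, mulVec_add, add_assoc]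

end Pathwise

section Measurability

variable {D : LQProblem n m p Ω} {wbar : Fin n → ℝ} {W : Matrix (Fin n) (Fin n) ℝ}
  {S : Matrix (Fin m) (Fin m) ℝ} {u : ℕ → Ω → Fin p → ℝ}

lemma measurable_output_obsInfo {s t : ℕ} (h : s ≤ t) :
    Measurable[D.obsInfo u t] (D.output u s) :=
  Measurable.mono (comap_measurable _)
    (le_sup_of_le_left (le_iSup₂_of_le s h le_rfl)) le_rfl

lemma measurable_control_obsInfo {s t : ℕ} (h : s < t) : Measurable[D.obsInfo u t] (u s) :=
  Measurable.mono (comap_measurable _)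
    (le_sup_of_le_right (le_iSup₂_of_le s h le_rfl)) le_rfl

lemma measurable_residual_residualInfo {s t : ℕ} (h : s < t) :
    Measurable[D.residualInfo wbar W S t] (D.residual wbar W S s) :=
  @measurable_pi_lambda _ _ _ (D.residualInfo wbar W S t) _ _ fun i =>
    (measurable_pi_apply ((⟨s, h⟩, i) : Fin t × Fin m)).comp
      (comap_measurable fun ω (q : Fin t × Fin m) => D.residual wbar W S q.1 ω q.2)

lemma residualInfo_mono {s t : ℕ} (h : s ≤ t) :
    D.residualInfo wbar W S s ≤ D.residualInfo wbar W S t :=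
  Measurable.comap_le <| @measurable_pi_lambda _ _ _ (D.residualInfo wbar W S t) _ _ fun q =>
    (measurable_pi_apply q.2).comp
      (measurable_residual_residualInfo (wbar := wbar) (W := W) (S := S) (by omega))

lemma residualInfo_zero : D.residualInfo wbar W S 0 = ⊥ := by
  refine le_bot_iff.mp (Measurable.comap_le ?_)
  have : (fun ω (q : Fin 0 × Fin m) => D.residual wbar W S q.1 ω q.2) = fun _ => 0 := by
    ext ω q
    exact q.1.elim0
  rw [this]
  exact @measurable_const _ _ _ ⊥ _

/-- The predictor and the residual can be computed from the observations, since the past controls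
and outputs determine the predictor recursively. -/
lemma measurable_predictor_residual_obsInfo {s t : ℕ} (h : s ≤ t) :
    Measurable[D.obsInfo u t] (D.predictor wbar W S u s) ∧
    Measurable[D.obsInfo u t] (D.residual wbar W S s) := by
  let _ := D.obsInfo u t
  have aux (s : ℕ) (hs : s ≤ t) (h1 : Measurable (D.predictor wbar W S u s)) :
      Measurable (D.residual wbar W S s) := by
    have h2 : D.residual wbar W S s
        = fun ω => D.output u s ω - D.C *ᵥ D.predictor wbar W S u s ω := by
      ext1 ω
      rw [output_eq_add D wbar W S]
      abel
    have h3 : Measurable (D.output u s) := measurable_output_obsInfo hs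
    rw [h2]
    fun_prop
  induction s with
  | zero =>
    have h0 : Measurable (D.predictor wbar W S u 0) := measurable_const
    exact ⟨h0, aux 0 h h0⟩
  | succ s ih =>
    obtain ⟨h1, h2⟩ := ih (by omega)
    have h3 : Measurable (u s) := measurable_control_obsInfo h
    have h4 : Measurable (D.predictor wbar W S u (s + 1)) := by
      rw [predictor_succ]
      unfold corrector
      fun_prop
    exact ⟨h4, aux _ h h4⟩

lemma residualInfo_le_obsInfo (t : ℕ) : D.residualInfo wbar W S (t + 1) ≤ D.obsInfo u t :=
  Measurable.comap_le <| @measurable_pi_lambda _ _ _ (D.obsInfo u t) _ _ fun q =>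
    (measurable_pi_apply q.2).comp
      (measurable_predictor_residual_obsInfo (wbar := wbar) (W := W) (S := S)
        (show (q.1 : ℕ) ≤ t by omega)).2

lemma measurable_predictor_residualInfo {s t : ℕ}
    (hu : ∀ s < t, Measurable[D.residualInfo wbar W S (s + 1)] (u s)) (hs : s ≤ t) :
    Measurable[D.residualInfo wbar W S s] (D.predictor wbar W S u s) := by
  induction s with
  | zero => exact @measurable_const _ _ _ (D.residualInfo wbar W S 0) _
  | succ s ih =>
    let _ := D.residualInfo wbar W S (s + 1)
    have h1 : Measurable (D.predictor wbar W S u s) :=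
      (ih (by omega)).mono (residualInfo_mono (by omega)) le_rfl
    have h2 : Measurable (u s) := hu s hs
    have h3 : Measurable (D.residual wbar W S s) := measurable_residual_residualInfo (by omega)
    rw [predictor_succ]
    unfold corrector
    fun_prop

lemma measurable_corrector_residualInfo {t : ℕ}
    (hu : ∀ s < t, Measurable[D.residualInfo wbar W S (s + 1)] (u s)) :
    Measurable[D.residualInfo wbar W S (t + 1)] (D.corrector wbar W S u t) := by
  let _ := D.residualInfo wbar W S (t + 1)
  have h1 : Measurable (D.predictor wbar W S u t) :=
    (measurable_predictor_residualInfo hu le_rfl).mono (residualInfo_mono (by omega)) le_rfl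
  have h2 : Measurable (D.residual wbar W S t) := measurable_residual_residualInfo (by omega)
  unfold corrector
  fun_prop

lemma obsInfo_le_residualInfo {t : ℕ}
    (hu : ∀ s < t, Measurable[D.residualInfo wbar W S (s + 1)] (u s)) :
    D.obsInfo u t ≤ D.residualInfo wbar W S (t + 1) := by
  refine sup_le (iSup₂_le fun s hs => Measurable.comap_le ?_)
    (iSup₂_le fun s hs => Measurable.comap_le ((hu s hs).mono
      (residualInfo_mono (by simp at hs; omega)) le_rfl))
  simp only [Set.mem_Iic] at hs
  let _ := D.residualInfo wbar W S (t + 1)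
  have h1 : Measurable (D.predictor wbar W S u s) :=
    (measurable_predictor_residualInfo hu hs).mono (residualInfo_mono (by omega)) le_rfl
  have h2 : Measurable (D.residual wbar W S s) := measurable_residual_residualInfo (by omega)
  have h3 : D.output u s = fun ω => D.C *ᵥ D.predictor wbar W S u s ω + D.residual wbar W S s ω :=
    funext (D.output_eq_add wbar W S u s)
  rw [h3]
  fun_prop

lemma obsInfo_eq_residualInfo {t : ℕ}
    (hu : ∀ s < t, Measurable[D.residualInfo wbar W S (s + 1)] (u s)) :
    D.obsInfo u t = D.residualInfo wbar W S (t + 1) :=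
  le_antisymm (obsInfo_le_residualInfo hu) (residualInfo_le_obsInfo t)

/-- A causal control is a function of the residuals alone, which do not depend on it. -/
lemma measurable_control_residualInfo [MeasurableSpace Ω] {P : Measure Ω}
    (hu : u ∈ D.admissible P) {t : ℕ} (ht : t < D.N) :
    Measurable[D.residualInfo wbar W S (t + 1)] (u t) := by
  induction t using Nat.strong_induction_on with
  | _ t ih =>
    rw [← obsInfo_eq_residualInfo fun s hs => ih s hs (hs.trans ht)]
    exact (hu t ht).1

lemma info_eq_sup (t : ℕ) :
    D.info u t = D.obsInfo u t ⊔ MeasurableSpace.comap (u t) inferInstance := by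
  have h : (⨆ s ∈ Set.Iic t, MeasurableSpace.comap (u s) inferInstance)
      = (⨆ s ∈ Set.Iio t, MeasurableSpace.comap (u s) inferInstance)
        ⊔ MeasurableSpace.comap (u t) inferInstance := by
    rw [← Set.Iio_insert, iSup_insert, sup_comm]
  rw [info, h, obsInfo, sup_assoc]

/-- The information available does not depend on the control: there is no dual effect. -/
lemma info_eq_residualInfo [MeasurableSpace Ω] {P : Measure Ω}
    (hu : u ∈ D.admissible P) {t : ℕ} (ht : t < D.N) :
    D.info u t = D.residualInfo wbar W S (t + 1) := by
  rw [info_eq_sup, obsInfo_eq_residualInfo fun s hs =>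
    measurable_control_residualInfo hu (hs.trans ht)]
  exact sup_eq_left.mpr (measurable_control_residualInfo hu ht).comap_le

lemma pastInfo_eq_residualInfo [MeasurableSpace Ω] {P : Measure Ω}
    (hu : u ∈ D.admissible P) {t : ℕ} (ht : t ≤ D.N) :
    D.pastInfo u t = D.residualInfo wbar W S t := by
  cases t with
  | zero => exact residualInfo_zero.symm
  | succ t => exact info_eq_residualInfo hu ht

lemma residualInfo_le [mΩ : MeasurableSpace Ω] {P : Measure Ω}
    (hnoise : IsGaussianNoise P D.w D.v wbar W S) (t : ℕ) : D.residualInfo wbar W S t ≤ mΩ :=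
  Measurable.comap_le <| measurable_pi_lambda _ fun q =>
    (measurable_pi_apply q.2).comp (measurable_residual hnoise q.1)

end Measurability

/-! ### Conditional expectations given the information -/

section Conditional

variable [mΩ : MeasurableSpace Ω] {P : Measure Ω} {D : LQProblem n m p Ω}
  {wbar : Fin n → ℝ} {W : Matrix (Fin n) (Fin n) ℝ} {S : Matrix (Fin m) (Fin m) ℝ}
  {u : ℕ → Ω → Fin p → ℝ}

lemma memLp_residual (hnoise : IsGaussianNoise P D.w D.v wbar W S) (t : ℕ) :
    MemLp (D.residual wbar W S t) 4 P :=
  (hasGaussianLaw_residual hnoise t).memLp (by simp)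

lemma measurable_correctedError (hnoise : IsGaussianNoise P D.w D.v wbar W S) (t : ℕ) :
    Measurable (D.correctedError wbar W S t) := by
  have := measurable_filterError hnoise t
  have := measurable_residual hnoise t
  unfold correctedError
  fun_prop

lemma integrable_filterError (hnoise : IsGaussianNoise P D.w D.v wbar W S) (t : ℕ) :
    Integrable (D.filterError wbar W S t) P := (hasGaussianLaw_filterError hnoise t).integrable

lemma memLp_control (hu : u ∈ D.admissible P) {t : ℕ} (ht : t ≤ D.N) :
    ∀ s < t, MemLp (u s) 4 P := fun s hs => (hu s (hs.trans_le ht)).2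

variable [IsProbabilityMeasure P]

lemma memLp_predictor (hnoise : IsGaussianNoise P D.w D.v wbar W S) {t : ℕ}
    (hu : ∀ s < t, MemLp (u s) 4 P) : MemLp (D.predictor wbar W S u t) 4 P := by
  induction t with
  | zero => exact memLp_const _
  | succ t ih =>
    exact ((memLp_mulVec D.A ((ih fun s hs => hu s (by omega)).add (memLp_mulVec _
      (memLp_residual hnoise t)))).add (memLp_mulVec D.B (hu t (by omega)))).add (memLp_const wbar)

lemma memLp_corrector (hnoise : IsGaussianNoise P D.w D.v wbar W S) {t : ℕ}
    (hu : ∀ s < t, MemLp (u s) 4 P) : MemLp (D.corrector wbar W S u t) 4 P :=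
  (memLp_predictor hnoise hu).add (memLp_mulVec _ (memLp_residual hnoise t))

lemma integrable_of_memLp_four {E : Type*} [NormedAddCommGroup E] {X : Ω → E}
    (hX : MemLp X 4 P) : Integrable X P := hX.integrable (by norm_num)

lemma indep_filterError (hnoise : IsGaussianNoise P D.w D.v wbar W S) {t : ℕ}
    (hinv : ∀ t, 1 ≤ t → t < D.N → IsUnit (D.C * D.kalmanCov W S t * D.Cᵀ + S).det)
    (ht : t ≤ D.N) :
    IndepFun (D.filterError wbar W S t)
      (fun ω (q : Fin t × Fin m) => D.residual wbar W S q.1 ω q.2) P :=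
  indep_residualInfo hnoise (D.linearlyGenerated_filterError le_rfl)
    (measurable_filterError hnoise t) (Nat.le_succ t) (crossCov_filterError hnoise hinv ht).2

lemma indep_correctedError (hnoise : IsGaussianNoise P D.w D.v wbar W S) {t : ℕ}
    (hinv : ∀ t, 1 ≤ t → t < D.N → IsUnit (D.C * D.kalmanCov W S t * D.Cᵀ + S).det)
    (ht : t < D.N) :
    IndepFun (D.correctedError wbar W S t)
      (fun ω (q : Fin (t + 1) × Fin m) => D.residual wbar W S q.1 ω q.2) P := by
  obtain ⟨h1, h2⟩ := crossCov_filterError hnoise hinv ht.le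
  exact indep_residualInfo hnoise (D.linearlyGenerated_correctedError t)
    (measurable_correctedError hnoise t) le_rfl (crossCov_step hnoise hinv ht h1 h2).2.1

lemma indep_residual (hnoise : IsGaussianNoise P D.w D.v wbar W S) {t : ℕ}
    (hinv : ∀ t, 1 ≤ t → t < D.N → IsUnit (D.C * D.kalmanCov W S t * D.Cᵀ + S).det)
    (ht : t < D.N) :
    IndepFun (D.residual wbar W S t)
      (fun ω (q : Fin t × Fin m) => D.residual wbar W S q.1 ω q.2) P := by
  obtain ⟨h1, h2⟩ := crossCov_filterError hnoise hinv ht.le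
  exact indep_residualInfo hnoise (D.linearlyGenerated_residual le_rfl)
    (measurable_residual hnoise t) (Nat.le_succ t) (crossCov_step hnoise hinv ht h1 h2).1

lemma integral_filterError (hnoise : IsGaussianNoise P D.w D.v wbar W S) (t : ℕ) :
    ∫ ω, D.filterError wbar W S t ω ∂P = 0 :=
  integral_eq_zero_of_linearlyGenerated hnoise (D.linearlyGenerated_filterError le_rfl)

/-- The state exceeds the predictor by the filtering error, which is independent of the past. -/
lemma prediction_ae_eq (hnoise : IsGaussianNoise P D.w D.v wbar W S)
    (hinv : ∀ t, 1 ≤ t → t < D.N → IsUnit (D.C * D.kalmanCov W S t * D.Cᵀ + S).det)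
    (hu : u ∈ D.admissible P) {t : ℕ} (ht : t ≤ D.N) :
    D.prediction P u t =ᵐ[P] D.predictor wbar W S u t := by
  rw [prediction, pastInfo_eq_residualInfo (wbar := wbar) (W := W) (S := S) hu ht,
    funext (D.state_eq_add wbar W S u t)]
  exact condExp_add_of_indep (residualInfo_le hnoise t)
    (measurable_predictor_residualInfo
      (fun s hs => measurable_control_residualInfo hu (hs.trans_le ht)) le_rfl)
    (integrable_of_memLp_four (memLp_predictor hnoise (memLp_control hu ht)))
    (measurable_filterError hnoise t) (integrable_filterError hnoise t)
    (indep_filterError hnoise hinv ht) (integral_filterError hnoise t)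

lemma innovation_ae_eq (hnoise : IsGaussianNoise P D.w D.v wbar W S)
    (hinv : ∀ t, 1 ≤ t → t < D.N → IsUnit (D.C * D.kalmanCov W S t * D.Cᵀ + S).det)
    (hu : u ∈ D.admissible P) {t : ℕ} (ht : t ≤ D.N) :
    D.innovation P u t =ᵐ[P] D.filterError wbar W S t := by
  filter_upwards [prediction_ae_eq hnoise hinv hu ht] with ω h
  rw [innovation, h, state_eq_add D wbar W S]
  abel

/-- The state exceeds the Kalman filter by the corrected error, which is independent of the
information at time `t`. -/
lemma estimate_ae_eq (hnoise : IsGaussianNoise P D.w D.v wbar W S)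
    (hinv : ∀ t, 1 ≤ t → t < D.N → IsUnit (D.C * D.kalmanCov W S t * D.Cᵀ + S).det)
    (hu : u ∈ D.admissible P) {t : ℕ} (ht : t < D.N) :
    D.estimate P u t =ᵐ[P] D.corrector wbar W S u t := by
  rw [estimate, info_eq_residualInfo (wbar := wbar) (W := W) (S := S) hu ht,
    funext (D.state_eq_corrector_add wbar W S u t)]
  exact condExp_add_of_indep (residualInfo_le hnoise _)
    (measurable_corrector_residualInfo fun s hs => measurable_control_residualInfo hu (hs.trans ht))
    (integrable_of_memLp_four (memLp_corrector hnoise (memLp_control hu ht.le)))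
    (measurable_correctedError hnoise t)
    ((memLp_correctedError hnoise t).integrable (by norm_num))
    (indep_correctedError hnoise hinv ht)
    (integral_eq_zero_of_linearlyGenerated hnoise (D.linearlyGenerated_correctedError t))

/-- A function of the prediction error at time `t + 1` is independent of the information at
time `t`, so that conditioning replaces it by its mean. -/
lemma condExp_comp_innovation (hnoise : IsGaussianNoise P D.w D.v wbar W S)
    (hinv : ∀ t, 1 ≤ t → t < D.N → IsUnit (D.C * D.kalmanCov W S t * D.Cᵀ + S).det)
    (hu : u ∈ D.admissible P) {t : ℕ} (ht : t < D.N) {F : Type*} [NormedAddCommGroup F]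
    [NormedSpace ℝ F] [CompleteSpace F] {f : (Fin n → ℝ) → F} (hf : StronglyMeasurable f) :
    condExp (D.info u t) P (fun ω => f (D.innovation P u (t + 1) ω))
      =ᵐ[P] fun _ => ∫ ω, f (D.filterError wbar W S (t + 1) ω) ∂P := by
  rw [info_eq_residualInfo (wbar := wbar) (W := W) (S := S) hu ht]
  have h1 : (fun ω => f (D.innovation P u (t + 1) ω))
      =ᵐ[P] fun ω => f (D.filterError wbar W S (t + 1) ω) :=
    (innovation_ae_eq hnoise hinv hu ht).fun_comp f
  refine (condExp_congr_ae h1).trans ?_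
  exact condExp_indep_eq (measurable_filterError hnoise (t + 1)).comap_le
    (residualInfo_le hnoise _) (hf.comp_measurable (comap_measurable _))
    (indep_filterError hnoise hinv ht)

/-- The conditional covariance of the innovation is deterministic: it is the Kalman covariance. -/
lemma condCov_ae_eq (hnoise : IsGaussianNoise P D.w D.v wbar W S)
    (hinv : ∀ t, 1 ≤ t → t < D.N → IsUnit (D.C * D.kalmanCov W S t * D.Cᵀ + S).det)
    (hu : u ∈ D.admissible P) {t : ℕ} (ht : t < D.N) :
    ∀ᵐ ω ∂P, D.condCov P u t ω = D.kalmanCov W S (t + 1) := by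
  have h (i j : Fin n) := condExp_comp_innovation hnoise hinv hu ht (f := fun x => x i * x j)
    (by fun_prop)
  simp only [Filter.EventuallyEq] at h
  filter_upwards [ae_all_iff.mpr fun i => ae_all_iff.mpr (h i)] with ω h
  ext i j
  have hX := (hasGaussianLaw_filterError hnoise (t + 1)).memLp_two
  have h0 (i : Fin n) : ∫ ω, D.filterError wbar W S (t + 1) ω i ∂P = 0 := by
    rw [← eval_integral (fun i => (integrable_filterError hnoise (t + 1)).eval i),
      integral_filterError hnoise]
    rfl
  rw [condCov, of_apply, h i j, ← (crossCov_filterError hnoise hinv ht).1, crossCov, of_apply,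
    covariance_eq_sub (hX.eval i) (hX.eval j), h0, h0, mul_zero, sub_zero]
  rfl

end Conditional

/-! ### Completion of squares -/

lemma dotProduct_mulVec_symm {a : ℕ} {M : Matrix (Fin a) (Fin a) ℝ} (hM : Mᵀ = M)
    (x y : Fin a → ℝ) : x ⬝ᵥ M *ᵥ y = y ⬝ᵥ M *ᵥ x := by
  conv_lhs => rw [← hM]
  rw [mulVec_transpose, dotProduct_comm, ← dotProduct_mulVec]

/-- The matrix `(A + BK)' V (A + BK) + K' R K` of the quadratic cost-to-go after minimization over
the control. -/
noncomputable def closedLoopCost (D : LQProblem n m p Ω) (V : Matrix (Fin n) (Fin n) ℝ) :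
    Matrix (Fin n) (Fin n) ℝ :=
  (D.A + D.B * D.gainOf V)ᵀ * V * (D.A + D.B * D.gainOf V) + (D.gainOf V)ᵀ * D.R * D.gainOf V

/-- One step of the dynamic programme: completing the square in the control `u`. -/
lemma completion_of_squares (D : LQProblem n m p Ω) {V : Matrix (Fin n) (Fin n) ℝ} (hV : Vᵀ = V)
    (hR : D.Rᵀ = D.R) (hM : IsUnit (D.Bᵀ * V * D.B + D.R).det) (ξ c : Fin n → ℝ)
    {l : Fin p → ℝ} (hl : l = -((D.Bᵀ * V * D.B + D.R)⁻¹ *ᵥ (D.Bᵀ *ᵥ (ξ + V *ᵥ c))))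
    (x : Fin n → ℝ) (u : Fin p → ℝ) :
    (D.A *ᵥ x + D.B *ᵥ u + c) ⬝ᵥ V *ᵥ (D.A *ᵥ x + D.B *ᵥ u + c)
        + 2 * (ξ ⬝ᵥ (D.A *ᵥ x + D.B *ᵥ u + c)) + u ⬝ᵥ D.R *ᵥ u
      = (u - (D.gainOf V *ᵥ x + l)) ⬝ᵥ (D.Bᵀ * V * D.B + D.R) *ᵥ (u - (D.gainOf V *ᵥ x + l))
        + (x ⬝ᵥ D.closedLoopCost V *ᵥ x
          + 2 * (((D.A + D.B * D.gainOf V)ᵀ *ᵥ (ξ + V *ᵥ c)) ⬝ᵥ x))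
        + (c ⬝ᵥ V *ᵥ c + 2 * (ξ ⬝ᵥ c) - l ⬝ᵥ (D.Bᵀ * V * D.B + D.R) *ᵥ l) := by
  have hMmul (d e : Fin p → ℝ) : d ⬝ᵥ (D.Bᵀ * V * D.B + D.R) *ᵥ e
      = (D.B *ᵥ d) ⬝ᵥ V *ᵥ (D.B *ᵥ e) + d ⬝ᵥ D.R *ᵥ e := by
    rw [add_mulVec, dotProduct_add, ← mulVec_mulVec, ← mulVec_mulVec, mulVec_transpose,
      dotProduct_comm d, ← dotProduct_mulVec, dotProduct_comm]
  set M := D.Bᵀ * V * D.B + D.R with hMdef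
  set K := D.gainOf V with hK
  have hMK : M * K = -(D.Bᵀ * V * D.A) := by
    rw [hK, gainOf, ← hMdef, Matrix.mul_neg, Matrix.mul_nonsing_inv_cancel_left _ _ hM]
  have hMl : M *ᵥ l = -(D.Bᵀ *ᵥ (ξ + V *ᵥ c)) := by
    rw [hl, mulVec_neg, mulVec_mulVec, Matrix.mul_nonsing_inv _ hM, one_mulVec]
  have hB (d : Fin p → ℝ) (y : Fin n → ℝ) : d ⬝ᵥ D.Bᵀ *ᵥ y = (D.B *ᵥ d) ⬝ᵥ y := by
    rw [mulVec_transpose, dotProduct_comm d, ← dotProduct_mulVec, dotProduct_comm]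
  obtain ⟨k, hk⟩ : ∃ k, k = K *ᵥ x := ⟨_, rfl⟩
  obtain ⟨f, hf⟩ : ∃ f, f = D.A *ᵥ x + D.B *ᵥ k := ⟨_, rfl⟩
  have hf' : f = (D.A + D.B * K) *ᵥ x := by rw [hf, hk, add_mulVec, mulVec_mulVec]
  -- Stationarity in the state direction.
  have h1 (d : Fin p → ℝ) : (D.B *ᵥ d) ⬝ᵥ V *ᵥ f + d ⬝ᵥ D.R *ᵥ k = 0 := by
    have e1 := hMmul d k
    have e2 : d ⬝ᵥ M *ᵥ k = -((D.B *ᵥ d) ⬝ᵥ V *ᵥ (D.A *ᵥ x)) := by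
      rw [hk, mulVec_mulVec, hMK, neg_mulVec, dotProduct_neg, ← mulVec_mulVec, ← mulVec_mulVec, hB]
    rw [hf, mulVec_add, dotProduct_add]
    linarith
  -- Stationarity of the constant term.
  have h2 (d : Fin p → ℝ) : (D.B *ᵥ d) ⬝ᵥ V *ᵥ (D.B *ᵥ l) + d ⬝ᵥ D.R *ᵥ l
      + (D.B *ᵥ d) ⬝ᵥ ξ + (D.B *ᵥ d) ⬝ᵥ V *ᵥ c = 0 := by
    have e1 := hMmul d l
    rw [hMl, dotProduct_neg, hB, dotProduct_add] at e1
    linarith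
  have h3 : x ⬝ᵥ D.closedLoopCost V *ᵥ x = f ⬝ᵥ V *ᵥ f + k ⬝ᵥ D.R *ᵥ k := by
    rw [closedLoopCost, ← hK, add_mulVec, dotProduct_add, ← mulVec_mulVec, ← mulVec_mulVec,
      ← mulVec_mulVec, ← mulVec_mulVec, ← hf', ← hk, mulVec_transpose, mulVec_transpose,
      dotProduct_comm x, dotProduct_comm x, ← dotProduct_mulVec, ← dotProduct_mulVec, ← hf', ← hk,
      dotProduct_comm _ f, dotProduct_comm _ k]
  have h4 : ((D.A + D.B * K)ᵀ *ᵥ (ξ + V *ᵥ c)) ⬝ᵥ x = ξ ⬝ᵥ f + f ⬝ᵥ V *ᵥ c := by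
    rw [mulVec_transpose, ← dotProduct_mulVec, ← hf', add_dotProduct, dotProduct_comm (V *ᵥ c) f]
  obtain ⟨d, rfl⟩ : ∃ d, u = d + (k + l) := ⟨u - (k + l), by abel⟩
  have h5 : D.A *ᵥ x + D.B *ᵥ (d + (k + l)) + c = f + D.B *ᵥ d + D.B *ᵥ l + c := by
    rw [hf, mulVec_add, mulVec_add]
    abel
  rw [h5, h3, h4, ← hk, add_sub_cancel_right, hMmul, hMmul]
  have hVs := dotProduct_mulVec_symm hV
  have hRs := dotProduct_mulVec_symm hR
  simp only [mulVec_add, dotProduct_add, add_dotProduct]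
  rw [hVs f (D.B *ᵥ d), hVs f (D.B *ᵥ l), hVs c (D.B *ᵥ d), hVs c (D.B *ᵥ l), hVs c f,
    hVs (D.B *ᵥ l) (D.B *ᵥ d), hRs k d, hRs k l, hRs l d, dotProduct_comm ξ (D.B *ᵥ d),
    dotProduct_comm ξ (D.B *ᵥ l)]
  linear_combination 2 * h1 d + 2 * h1 l + 2 * h2 d + 2 * h2 l

/-! ### The backward recursion -/

lemma posSemidef_closedLoopCost (D : LQProblem n m p Ω) (hR : D.R.PosDef)
    {V : Matrix (Fin n) (Fin n) ℝ} (hV : V.PosSemidef) : (D.closedLoopCost V).PosSemidef := by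
  have h1 := hV.conjTranspose_mul_mul_same (D.A + D.B * D.gainOf V)
  have h2 := hR.posSemidef.conjTranspose_mul_mul_same (D.gainOf V)
  simp only [conjTranspose_eq_transpose_of_trivial] at h1 h2
  exact h1.add h2

lemma posDef_quadratic (D : LQProblem n m p Ω) (hR : D.R.PosDef)
    {V : Matrix (Fin n) (Fin n) ℝ} (hV : V.PosSemidef) : (D.Bᵀ * V * D.B + D.R).PosDef := by
  have h1 := hV.conjTranspose_mul_mul_same D.B
  simp only [conjTranspose_eq_transpose_of_trivial] at h1
  exact hR.posSemidef_add h1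

/-- The matrix of the cost-to-go as a quadratic function of the prediction at time `t`, extended
by `0` to the end of the horizon. -/
noncomputable def valueMat (D : LQProblem n m p Ω) (W : Matrix (Fin n) (Fin n) ℝ)
    (S : Matrix (Fin m) (Fin m) ℝ) (mu : ℝ) (t : ℕ) : Matrix (Fin n) (Fin n) ℝ :=
  if t < D.N then D.closedLoopCost (D.costMat W S mu t) else 0

/-- The linear part of the cost-to-go, extended by `0` to the end of the horizon. -/
noncomputable def valueVec (D : LQProblem n m p Ω) (wbar : Fin n → ℝ)
    (W : Matrix (Fin n) (Fin n) ℝ) (S : Matrix (Fin m) (Fin m) ℝ) (mu : ℝ) (t : ℕ) :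
    Fin n → ℝ :=
  if t < D.N then (D.A + D.B * D.controlGain W S mu t)ᵀ *ᵥ
    (D.costVec wbar W S mu t + D.costMat W S mu t *ᵥ wbar) else 0

section Backward

variable (D : LQProblem n m p Ω) (wbar : Fin n → ℝ) (W : Matrix (Fin n) (Fin n) ℝ)
  (S : Matrix (Fin m) (Fin m) ℝ) (mu : ℝ)

lemma costMat_eq (t : ℕ) :
    D.costMat W S mu t = D.valueMat W S mu (t + 1) + D.inflatedQ W S mu t := by
  rw [costMat, valueMat]
  split_ifs
  · rfl
  · rw [zero_add]

lemma costVec_eq (t : ℕ) : D.costVec wbar W S mu t = D.valueVec wbar W S mu (t + 1) := by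
  rw [costVec, valueVec]

lemma posSemidef_costMat (hR : D.R.PosDef)
    (hQ : ∀ t < D.N, (D.inflatedQ W S mu t).PosSemidef) {t : ℕ} (ht : t < D.N) :
    (D.costMat W S mu t).PosSemidef := by
  obtain ⟨k, hk⟩ : ∃ k, t + k + 1 = D.N := ⟨D.N - t - 1, by omega⟩
  induction k generalizing t with
  | zero =>
    rw [costMat_eq, valueMat, if_neg (by omega), zero_add]
    exact hQ t ht
  | succ k ih =>
    rw [costMat_eq, valueMat, if_pos (by omega)]
    exact (posSemidef_closedLoopCost D hR (ih (by omega) (by omega))).add (hQ t ht)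

end Backward

/-! ### The Lagrangian as a sum of squares -/

/-- The deviation `u_t - (K_t a_t + l_t)` of the control from the affine feedback of the Kalman
filter `a_t`. -/
noncomputable def feedbackGap (D : LQProblem n m p Ω) (wbar : Fin n → ℝ)
    (W : Matrix (Fin n) (Fin n) ℝ) (S : Matrix (Fin m) (Fin m) ℝ) (mu : ℝ)
    (u : ℕ → Ω → Fin p → ℝ) (t : ℕ) (ω : Ω) : Fin p → ℝ :=
  u t ω - (D.controlGain W S mu t *ᵥ D.corrector wbar W S u t ω + D.controlShift wbar W S mu t)

/-- The integrated quadratic form of the deviation from the feedback: the excess cost of the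
control `u` at time `t`. -/
noncomputable def excessCost [MeasurableSpace Ω] (D : LQProblem n m p Ω) (P : Measure Ω)
    (wbar : Fin n → ℝ) (W : Matrix (Fin n) (Fin n) ℝ) (S : Matrix (Fin m) (Fin m) ℝ) (mu : ℝ)
    (u : ℕ → Ω → Fin p → ℝ) (t : ℕ) : ℝ :=
  ∫ ω, D.feedbackGap wbar W S mu u t ω ⬝ᵥ (D.Bᵀ * D.costMat W S mu t * D.B + D.R) *ᵥ
    D.feedbackGap wbar W S mu u t ω ∂P

/-- The expectation of the minimal cost-to-go at time `t`, a function of the prediction, up to an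
additive constant. -/
noncomputable def expectedValue [MeasurableSpace Ω] (D : LQProblem n m p Ω) (P : Measure Ω)
    (wbar : Fin n → ℝ) (W : Matrix (Fin n) (Fin n) ℝ) (S : Matrix (Fin m) (Fin m) ℝ) (mu : ℝ)
    (u : ℕ → Ω → Fin p → ℝ) (t : ℕ) : ℝ :=
  ∫ ω, D.predictor wbar W S u t ω ⬝ᵥ D.valueMat W S mu t *ᵥ D.predictor wbar W S u t ω ∂P
    + 2 * ∫ ω, D.valueVec wbar W S mu t ⬝ᵥ D.predictor wbar W S u t ω ∂P

/-- The control-free part of the cost incurred at time `t`, including the cost of the filter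
correction. -/
noncomputable def stepConst [MeasurableSpace Ω] (D : LQProblem n m p Ω) (P : Measure Ω)
    (wbar : Fin n → ℝ) (W : Matrix (Fin n) (Fin n) ℝ) (S : Matrix (Fin m) (Fin m) ℝ) (mu : ℝ)
    (t : ℕ) : ℝ :=
  ∫ ω, (D.kalmanGain W S t *ᵥ D.residual wbar W S t ω) ⬝ᵥ D.valueMat W S mu t *ᵥ
      (D.kalmanGain W S t *ᵥ D.residual wbar W S t ω) ∂P
    + (wbar ⬝ᵥ D.costMat W S mu t *ᵥ wbar + 2 * (D.costVec wbar W S mu t ⬝ᵥ wbar)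
      - D.controlShift wbar W S mu t ⬝ᵥ (D.Bᵀ * D.costMat W S mu t * D.B + D.R) *ᵥ
        D.controlShift wbar W S mu t)

section Probability

variable [mΩ : MeasurableSpace Ω] {P : Measure Ω}
  {D : LQProblem n m p Ω} {wbar : Fin n → ℝ} {W : Matrix (Fin n) (Fin n) ℝ}
  {S : Matrix (Fin m) (Fin m) ℝ} {mu : ℝ} {u : ℕ → Ω → Fin p → ℝ}

lemma indepFun_predictor_of_indep {a t : ℕ} {Y : Ω → Fin a → ℝ}
    (hu : ∀ s < t, Measurable[D.residualInfo wbar W S (s + 1)] (u s))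
    (hY : IndepFun Y (fun ω (q : Fin t × Fin m) => D.residual wbar W S q.1 ω q.2) P) :
    IndepFun (D.predictor wbar W S u t) Y P :=
  (indep_of_indep_of_le_right (IndepFun_iff_Indep _ _ _ |>.mp hY)
    (measurable_predictor_residualInfo hu le_rfl).comap_le).symm

lemma memLp_filterError_two (hnoise : IsGaussianNoise P D.w D.v wbar W S) (t : ℕ) :
    MemLp (D.filterError wbar W S t) 2 P := (hasGaussianLaw_filterError hnoise t).memLp_two

variable [IsProbabilityMeasure P]

lemma memLp_two_of_four {E : Type*} [NormedAddCommGroup E] {X : Ω → E}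
    (hX : MemLp X 4 P) : MemLp X 2 P := hX.mono_exponent (by norm_num)

lemma posSemidef_kalmanCov (hnoise : IsGaussianNoise P D.w D.v wbar W S)
    (hinv : ∀ t, 1 ≤ t → t < D.N → IsUnit (D.C * D.kalmanCov W S t * D.Cᵀ + S).det)
    {t : ℕ} (ht : t ≤ D.N) : (D.kalmanCov W S t).PosSemidef := by
  rw [← (crossCov_filterError hnoise hinv ht).1]
  exact posSemidef_crossCov_self (hasGaussianLaw_filterError hnoise t).memLp_two

lemma posSemidef_inflatedQ (hnoise : IsGaussianNoise P D.w D.v wbar W S) (hQ : D.Q.PosSemidef)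
    (hinv : ∀ t, 1 ≤ t → t < D.N → IsUnit (D.C * D.kalmanCov W S t * D.Cᵀ + S).det)
    (hmu : 0 ≤ mu) {t : ℕ} (ht : t < D.N) : (D.inflatedQ W S mu t).PosSemidef := by
  have h := (posSemidef_kalmanCov hnoise hinv ht).conjTranspose_mul_mul_same D.Q
  rw [hQ.1] at h
  exact hQ.add (h.smul (by positivity))

lemma posSemidef_costMat_of_noise (hnoise : IsGaussianNoise P D.w D.v wbar W S)
    (hQ : D.Q.PosSemidef) (hR : D.R.PosDef)
    (hinv : ∀ t, 1 ≤ t → t < D.N → IsUnit (D.C * D.kalmanCov W S t * D.Cᵀ + S).det)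
    (hmu : 0 ≤ mu) {t : ℕ} (ht : t < D.N) : (D.costMat W S mu t).PosSemidef :=
  D.posSemidef_costMat W S mu hR (fun _ hs => posSemidef_inflatedQ hnoise hQ hinv hmu hs) ht

lemma memLp_feedbackGap (hnoise : IsGaussianNoise P D.w D.v wbar W S)
    (hu : u ∈ D.admissible P) {t : ℕ} (ht : t < D.N) :
    MemLp (D.feedbackGap wbar W S mu u t) 2 P :=
  memLp_two_of_four ((hu t ht).2.sub ((memLp_mulVec _
    (memLp_corrector hnoise (memLp_control hu ht.le))).add (memLp_const _)))

/-- The Bellman identity: the cost incurred at time `t` plus the expected cost-to-go at time `t + 1`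
is the expected cost-to-go at time `t` plus the excess cost plus a constant. The filter correction
is centred and independent of the prediction, so that it only contributes to the constant. -/
lemma bellman_step (hnoise : IsGaussianNoise P D.w D.v wbar W S)
    (hQ : D.Q.PosSemidef) (hR : D.R.PosDef)
    (hinv : ∀ t, 1 ≤ t → t < D.N → IsUnit (D.C * D.kalmanCov W S t * D.Cᵀ + S).det)
    (hmu : 0 ≤ mu) (hu : u ∈ D.admissible P) {t : ℕ} (ht : t < D.N) :
    ∫ ω, u t ω ⬝ᵥ D.R *ᵥ u t ω ∂P
      + ∫ ω, D.predictor wbar W S u (t + 1) ω ⬝ᵥ D.inflatedQ W S mu t *ᵥ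
          D.predictor wbar W S u (t + 1) ω ∂P
      + D.expectedValue P wbar W S mu u (t + 1)
    = D.expectedValue P wbar W S mu u t + D.excessCost P wbar W S mu u t
      + D.stepConst P wbar W S mu t := by
  have hV := posSemidef_costMat_of_noise hnoise hQ hR hinv hmu ht
  have hVt : (D.costMat W S mu t)ᵀ = D.costMat W S mu t := by
    simpa only [conjTranspose_eq_transpose_of_trivial] using hV.1.eq
  have hRt : D.Rᵀ = D.R := by
    simpa only [conjTranspose_eq_transpose_of_trivial] using hR.1.eq
  have hM : IsUnit (D.Bᵀ * D.costMat W S mu t * D.B + D.R).det :=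
    (Matrix.isUnit_iff_isUnit_det _).mp (D.posDef_quadratic hR hV).isUnit
  have hb' := memLp_two_of_four (memLp_predictor (t := t + 1) hnoise (memLp_control hu ht))
  have hb := memLp_two_of_four (memLp_predictor (t := t) hnoise (memLp_control hu ht.le))
  have ha := memLp_two_of_four (memLp_corrector (t := t) hnoise (memLp_control hu ht.le))
  have hut := memLp_two_of_four (hu t ht).2
  have hg := memLp_mulVec (D.kalmanGain W S t) (memLp_two_of_four (memLp_residual hnoise t))
  have hgap := memLp_feedbackGap (mu := mu) hnoise hu ht
  have hlinν := D.linearlyGenerated_residual (wbar := wbar) (W := W) (S := S) (le_refl t)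
  have hg0 : ∫ ω, D.kalmanGain W S t *ᵥ D.residual wbar W S t ω ∂P = 0 :=
    integral_eq_zero_of_linearlyGenerated hnoise (hlinν.mulVec (D.kalmanGain W S t))
  have hind : IndepFun (D.predictor wbar W S u t)
      (fun ω => D.kalmanGain W S t *ᵥ D.residual wbar W S t ω) P :=
    IndepFun.comp (φ := id) (ψ := fun y => D.kalmanGain W S t *ᵥ y)
      (indepFun_predictor_of_indep (fun s hs => measurable_control_residualInfo hu (hs.trans ht))
        (indep_residual hnoise hinv ht)) measurable_id (by fun_prop)
  have hsq (ω : Ω) := D.completion_of_squares hVt hRt hM (D.costVec wbar W S mu t) wbar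
    (l := D.controlShift wbar W S mu t) rfl (D.corrector wbar W S u t ω) (u t ω)
  have hVal : D.closedLoopCost (D.costMat W S mu t) = D.valueMat W S mu t := by
    rw [valueMat, if_pos ht]
  have hVec : (D.A + D.B * D.gainOf (D.costMat W S mu t))ᵀ *ᵥ
      (D.costVec wbar W S mu t + D.costMat W S mu t *ᵥ wbar) = D.valueVec wbar W S mu t := by
    rw [valueVec, if_pos ht, controlGain]
  rw [hVal, hVec] at hsq
  have hint := integral_congr_ae (μ := P) (Filter.Eventually.of_forall hsq)
  -- The left-hand side of the integrated identity.
  have hl : ∫ ω, ((D.predictor wbar W S u (t + 1) ω ⬝ᵥ D.costMat W S mu t *ᵥ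
        D.predictor wbar W S u (t + 1) ω
        + 2 * (D.costVec wbar W S mu t ⬝ᵥ D.predictor wbar W S u (t + 1) ω))
        + u t ω ⬝ᵥ D.R *ᵥ u t ω) ∂P
      = ∫ ω, u t ω ⬝ᵥ D.R *ᵥ u t ω ∂P
        + ∫ ω, D.predictor wbar W S u (t + 1) ω ⬝ᵥ D.inflatedQ W S mu t *ᵥ
          D.predictor wbar W S u (t + 1) ω ∂P
        + D.expectedValue P wbar W S mu u (t + 1) := by
    have i1 := integrable_dotProduct_mulVec (D.valueMat W S mu (t + 1)) hb' hb'
    have i2 := integrable_dotProduct_mulVec (D.inflatedQ W S mu t) hb' hb'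
    have i3 := (integrable_dotProduct_const (D.costVec wbar W S mu t) hb').const_mul 2
    have i4 := integrable_dotProduct_mulVec D.R hut hut
    have i5 := integrable_dotProduct_mulVec (D.costMat W S mu t) hb' hb'
    refine (integral_add (i5.add i3) i4).trans ?_
    simp only [Pi.add_apply]
    rw [integral_add i5 i3, integral_const_mul, expectedValue]
    simp only [costMat_eq, costVec_eq, add_mulVec, dotProduct_add]
    rw [integral_add i1 i2]
    ring
  have hr : ∫ ω, (D.feedbackGap wbar W S mu u t ω ⬝ᵥ
        (D.Bᵀ * D.costMat W S mu t * D.B + D.R) *ᵥ D.feedbackGap wbar W S mu u t ω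
        + (D.corrector wbar W S u t ω ⬝ᵥ D.valueMat W S mu t *ᵥ D.corrector wbar W S u t ω
          + 2 * (D.valueVec wbar W S mu t ⬝ᵥ D.corrector wbar W S u t ω))
        + (wbar ⬝ᵥ D.costMat W S mu t *ᵥ wbar + 2 * (D.costVec wbar W S mu t ⬝ᵥ wbar)
          - D.controlShift wbar W S mu t ⬝ᵥ (D.Bᵀ * D.costMat W S mu t * D.B + D.R) *ᵥ
            D.controlShift wbar W S mu t)) ∂P
      = D.expectedValue P wbar W S mu u t + D.excessCost P wbar W S mu u t
        + D.stepConst P wbar W S mu t := by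
    have i1 := integrable_dotProduct_mulVec (D.Bᵀ * D.costMat W S mu t * D.B + D.R) hgap hgap
    have i2 := integrable_dotProduct_mulVec (D.valueMat W S mu t) ha ha
    have i3 := (integrable_dotProduct_const (D.valueVec wbar W S mu t) ha).const_mul 2
    refine (integral_add (i1.add (i2.add i3)) (integrable_const _)).trans ?_
    refine (congrArg (· + _) (integral_add i1 (i2.add i3))).trans ?_
    simp only [Pi.add_apply]
    rw [integral_add i2 i3, integral_const_mul, integral_const, probReal_univ, one_smul]
    have e1 := integral_quadratic_add_of_indep (D.valueMat W S mu t) hb hg hind hg0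
    have e2 := integral_dotProduct_add (D.valueVec wbar W S mu t) hb hg hg0
    simp only [corrector]
    rw [e1, e2, expectedValue, excessCost, stepConst]
    ring
  rw [← hl, ← hr]
  exact hint

lemma sum_bellman (hnoise : IsGaussianNoise P D.w D.v wbar W S)
    (hQ : D.Q.PosSemidef) (hR : D.R.PosDef)
    (hinv : ∀ t, 1 ≤ t → t < D.N → IsUnit (D.C * D.kalmanCov W S t * D.Cᵀ + S).det)
    (hmu : 0 ≤ mu) (hu : u ∈ D.admissible P) :
    ∑ t ∈ Finset.range D.N, (∫ ω, u t ω ⬝ᵥ D.R *ᵥ u t ω ∂P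
      + ∫ ω, D.predictor wbar W S u (t + 1) ω ⬝ᵥ D.inflatedQ W S mu t *ᵥ
          D.predictor wbar W S u (t + 1) ω ∂P)
    = D.x0 ⬝ᵥ D.valueMat W S mu 0 *ᵥ D.x0 + 2 * (D.valueVec wbar W S mu 0 ⬝ᵥ D.x0)
      + ∑ t ∈ Finset.range D.N, D.stepConst P wbar W S mu t
      + ∑ t ∈ Finset.range D.N, D.excessCost P wbar W S mu u t := by
  have h0 : D.expectedValue P wbar W S mu u 0
      = D.x0 ⬝ᵥ D.valueMat W S mu 0 *ᵥ D.x0 + 2 * (D.valueVec wbar W S mu 0 ⬝ᵥ D.x0) := by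
    simp [expectedValue, predictor]
  have hN : D.expectedValue P wbar W S mu u D.N = 0 := by
    simp [expectedValue, valueMat, valueVec]
  have key := Finset.sum_range_sub (D.expectedValue P wbar W S mu u) D.N
  rw [h0, hN] at key
  have h1 : ∀ t ∈ Finset.range D.N, (∫ ω, u t ω ⬝ᵥ D.R *ᵥ u t ω ∂P
      + ∫ ω, D.predictor wbar W S u (t + 1) ω ⬝ᵥ D.inflatedQ W S mu t *ᵥ
          D.predictor wbar W S u (t + 1) ω ∂P)
      = D.stepConst P wbar W S mu t + D.excessCost P wbar W S mu u t
        - (D.expectedValue P wbar W S mu u (t + 1) - D.expectedValue P wbar W S mu u t) := by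
    intro t ht
    linarith [bellman_step hnoise hQ hR hinv hmu hu (Finset.mem_range.mp ht)]
  rw [Finset.sum_congr rfl h1, Finset.sum_sub_distrib, Finset.sum_add_distrib, key]
  ring

/-! ### The terms of the Lagrangian -/

lemma integral_state_quadratic (hnoise : IsGaussianNoise P D.w D.v wbar W S)
    (hinv : ∀ t, 1 ≤ t → t < D.N → IsUnit (D.C * D.kalmanCov W S t * D.Cᵀ + S).det)
    (hu : u ∈ D.admissible P) {t : ℕ} (ht : t ≤ D.N) :
    Integrable (fun ω => D.state u t ω ⬝ᵥ D.Q *ᵥ D.state u t ω) P ∧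
    ∫ ω, D.state u t ω ⬝ᵥ D.Q *ᵥ D.state u t ω ∂P
      = ∫ ω, D.predictor wbar W S u t ω ⬝ᵥ D.Q *ᵥ D.predictor wbar W S u t ω ∂P
        + ∫ ω, D.filterError wbar W S t ω ⬝ᵥ D.Q *ᵥ D.filterError wbar W S t ω ∂P := by
  have hb := memLp_two_of_four (memLp_predictor (t := t) hnoise (memLp_control hu ht))
  have he := memLp_filterError_two hnoise t
  simp only [D.state_eq_add wbar W S u]
  exact ⟨integrable_dotProduct_mulVec D.Q (hb.add he) (hb.add he),
    integral_quadratic_add_of_indep D.Q hb he (indepFun_predictor_of_indep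
      (fun s hs => measurable_control_residualInfo hu (hs.trans_le ht))
      (indep_filterError hnoise hinv ht)) (integral_filterError hnoise t)⟩

lemma cost_eq (hnoise : IsGaussianNoise P D.w D.v wbar W S)
    (hinv : ∀ t, 1 ≤ t → t < D.N → IsUnit (D.C * D.kalmanCov W S t * D.Cᵀ + S).det)
    (hu : u ∈ D.admissible P) :
    D.cost P u = D.x0 ⬝ᵥ D.Q *ᵥ D.x0
      + ∑ t ∈ Finset.range D.N, ∫ ω, D.filterError wbar W S (t + 1) ω ⬝ᵥ D.Q *ᵥ
          D.filterError wbar W S (t + 1) ω ∂P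
      + ∑ t ∈ Finset.range D.N, (∫ ω, u t ω ⬝ᵥ D.R *ᵥ u t ω ∂P
        + ∫ ω, D.predictor wbar W S u (t + 1) ω ⬝ᵥ D.Q *ᵥ
            D.predictor wbar W S u (t + 1) ω ∂P) := by
  have hx {t : ℕ} (ht : t ≤ D.N) := integral_state_quadratic hnoise hinv hu ht
  have hui {t : ℕ} (ht : t < D.N) : Integrable (fun ω => u t ω ⬝ᵥ D.R *ᵥ u t ω) P :=
    integrable_dotProduct_mulVec D.R (memLp_two_of_four (hu t ht).2)
      (memLp_two_of_four (hu t ht).2)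
  have hi : ∀ t ∈ Finset.range D.N, Integrable (fun ω => D.state u t ω ⬝ᵥ D.Q *ᵥ D.state u t ω
      + u t ω ⬝ᵥ D.R *ᵥ u t ω) P := fun t ht =>
    (hx (Finset.mem_range.mp ht).le).1.add (hui (Finset.mem_range.mp ht))
  rw [cost, integral_add (hx le_rfl).1 (integrable_finsetSum _ hi), integral_finsetSum _ hi,
    Finset.sum_congr rfl fun t ht => integral_add (hx (Finset.mem_range.mp ht).le).1
      (hui (Finset.mem_range.mp ht)), Finset.sum_add_distrib]
  have h0 : ∫ ω, D.state u 0 ω ⬝ᵥ D.Q *ᵥ D.state u 0 ω ∂P = D.x0 ⬝ᵥ D.Q *ᵥ D.x0 := by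
    simp [state]
  have hs := Finset.sum_range_succ (fun t => ∫ ω, D.state u t ω ⬝ᵥ D.Q *ᵥ D.state u t ω ∂P) D.N
  rw [Finset.sum_range_succ', h0, Finset.sum_congr rfl fun t ht =>
    (hx (Nat.succ_le_of_lt (Finset.mem_range.mp ht))).2, Finset.sum_add_distrib] at hs
  rw [Finset.sum_add_distrib]
  linarith

/-- The third moment drops out of the risk functional, since the prediction error is Gaussian and
centred. -/
lemma condThird_ae_eq_zero (hnoise : IsGaussianNoise P D.w D.v wbar W S)
    (hinv : ∀ t, 1 ≤ t → t < D.N → IsUnit (D.C * D.kalmanCov W S t * D.Cᵀ + S).det)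
    (hu : u ∈ D.admissible P) {t : ℕ} (ht : t < D.N) :
    ∀ᵐ ω ∂P, D.condThird P u t ω = 0 := by
  have hf : StronglyMeasurable (fun x : Fin n → ℝ => (x ⬝ᵥ D.Q *ᵥ x) • x) := by
    have : Continuous (fun x : Fin n → ℝ => (x ⬝ᵥ D.Q *ᵥ x) • x) := by fun_prop
    exact this.stronglyMeasurable
  filter_upwards [condExp_comp_innovation hnoise hinv hu ht hf] with ω h
  rw [condThird, h, (hasGaussianLaw_filterError hnoise (t + 1)).integral_odd_eq_zero
    (integral_filterError hnoise (t + 1)) hf (by simp [mulVec_neg])]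
  simp

lemma risk_eq (hnoise : IsGaussianNoise P D.w D.v wbar W S)
    (hinv : ∀ t, 1 ≤ t → t < D.N → IsUnit (D.C * D.kalmanCov W S t * D.Cᵀ + S).det)
    (hu : u ∈ D.admissible P) :
    D.risk P u = ∑ t ∈ Finset.range D.N, 4 * ∫ ω, D.predictor wbar W S u (t + 1) ω ⬝ᵥ
      (D.Q * D.kalmanCov W S (t + 1) * D.Q) *ᵥ D.predictor wbar W S u (t + 1) ω ∂P := by
  have h : ∀ᵐ ω ∂P, ∀ t : Fin D.N,
      D.prediction P u (t + 1) ω = D.predictor wbar W S u (t + 1) ω ∧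
      D.condCov P u t ω = D.kalmanCov W S (t + 1) ∧ D.condThird P u t ω = 0 :=
    ae_all_iff.mpr fun t => (prediction_ae_eq hnoise hinv hu t.2).and
      ((condCov_ae_eq hnoise hinv hu t.2).and (condThird_ae_eq_zero hnoise hinv hu t.2))
  have h' : (fun ω => ∑ t ∈ Finset.range D.N,
      (4 * (D.prediction P u (t + 1) ω ⬝ᵥ
        (D.Q * D.condCov P u t ω * D.Q) *ᵥ D.prediction P u (t + 1) ω)
      + 2 * (D.prediction P u (t + 1) ω ⬝ᵥ D.condThird P u t ω)))
      =ᵐ[P] fun ω => ∑ t ∈ Finset.range D.N, 4 * (D.predictor wbar W S u (t + 1) ω ⬝ᵥ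
        (D.Q * D.kalmanCov W S (t + 1) * D.Q) *ᵥ D.predictor wbar W S u (t + 1) ω) := by
    filter_upwards [h] with ω h
    refine Finset.sum_congr rfl fun t ht => ?_
    obtain ⟨h1, h2, h3⟩ := h ⟨t, Finset.mem_range.mp ht⟩
    simp only at h1 h2 h3
    rw [h1, h2, h3]
    simp
  rw [risk, integral_congr_ae h', integral_finsetSum]
  · exact Finset.sum_congr rfl fun t _ => integral_const_mul _ _
  · intro t ht
    have hb := memLp_two_of_four (memLp_predictor (t := t + 1) hnoise
      (memLp_control hu (Finset.mem_range.mp ht)))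
    exact (integrable_dotProduct_mulVec _ hb hb).const_mul 4

lemma epsBar_eq (hnoise : IsGaussianNoise P D.w D.v wbar W S)
    (hinv : ∀ t, 1 ≤ t → t < D.N → IsUnit (D.C * D.kalmanCov W S t * D.Cᵀ + S).det)
    (hu : u ∈ D.admissible P) :
    D.epsBar P u = D.eps - ∑ t ∈ Finset.range D.N,
      ∫ ω, (D.filterError wbar W S (t + 1) ω ⬝ᵥ D.Q *ᵥ D.filterError wbar W S (t + 1) ω
        - (D.Q * D.kalmanCov W S (t + 1)).trace) ^ 2 ∂P := by
  rw [epsBar]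
  congr 1
  refine Finset.sum_congr rfl fun t ht => ?_
  have ht := Finset.mem_range.mp ht
  rw [condFourth, info_eq_residualInfo (wbar := wbar) (W := W) (S := S) hu ht,
    integral_condExp (residualInfo_le hnoise _)]
  refine integral_congr_ae ?_
  filter_upwards [innovation_ae_eq hnoise hinv hu ht, condCov_ae_eq hnoise hinv hu ht]
    with ω h1 h2
  rw [h1, h2]

/-- The Lagrangian is a constant plus the excess costs: every other term depends on the noise
alone. -/
lemma exists_lagrangian_eq (hnoise : IsGaussianNoise P D.w D.v wbar W S)
    (hQ : D.Q.PosSemidef) (hR : D.R.PosDef)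
    (hinv : ∀ t, 1 ≤ t → t < D.N → IsUnit (D.C * D.kalmanCov W S t * D.Cᵀ + S).det)
    (hmu : 0 ≤ mu) :
    ∃ c : ℝ, ∀ u ∈ D.admissible P,
      D.lagrangian P u mu = c + ∑ t ∈ Finset.range D.N, D.excessCost P wbar W S mu u t := by
  refine ⟨D.x0 ⬝ᵥ D.Q *ᵥ D.x0
      + ∑ t ∈ Finset.range D.N, ∫ ω, D.filterError wbar W S (t + 1) ω ⬝ᵥ D.Q *ᵥ
          D.filterError wbar W S (t + 1) ω ∂P
      + (D.x0 ⬝ᵥ D.valueMat W S mu 0 *ᵥ D.x0 + 2 * (D.valueVec wbar W S mu 0 ⬝ᵥ D.x0)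
        + ∑ t ∈ Finset.range D.N, D.stepConst P wbar W S mu t)
      - mu * (D.eps - ∑ t ∈ Finset.range D.N,
        ∫ ω, (D.filterError wbar W S (t + 1) ω ⬝ᵥ D.Q *ᵥ D.filterError wbar W S (t + 1) ω
          - (D.Q * D.kalmanCov W S (t + 1)).trace) ^ 2 ∂P), fun u hu => ?_⟩
  have h1 := sum_bellman hnoise hQ hR hinv hmu hu
  have h2 : ∀ t ∈ Finset.range D.N, (∫ ω, u t ω ⬝ᵥ D.R *ᵥ u t ω ∂P
      + ∫ ω, D.predictor wbar W S u (t + 1) ω ⬝ᵥ D.inflatedQ W S mu t *ᵥ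
          D.predictor wbar W S u (t + 1) ω ∂P)
      = (∫ ω, u t ω ⬝ᵥ D.R *ᵥ u t ω ∂P + ∫ ω, D.predictor wbar W S u (t + 1) ω ⬝ᵥ D.Q *ᵥ
          D.predictor wbar W S u (t + 1) ω ∂P)
        + mu * (4 * ∫ ω, D.predictor wbar W S u (t + 1) ω ⬝ᵥ
          (D.Q * D.kalmanCov W S (t + 1) * D.Q) *ᵥ D.predictor wbar W S u (t + 1) ω ∂P) := by
    intro t ht
    have hb := memLp_two_of_four (memLp_predictor (t := t + 1) hnoise
      (memLp_control hu (Finset.mem_range.mp ht)))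
    simp only [inflatedQ, add_mulVec, smul_mulVec, dotProduct_add, dotProduct_smul, smul_eq_mul]
    rw [integral_add (integrable_dotProduct_mulVec _ hb hb)
      ((integrable_dotProduct_mulVec _ hb hb).const_mul _), integral_const_mul]
    ring
  rw [Finset.sum_congr rfl h2, Finset.sum_add_distrib, ← Finset.mul_sum] at h1
  rw [lagrangian, cost_eq hnoise hinv hu, risk_eq hnoise hinv hu, epsBar_eq hnoise hinv hu]
  linarith

end Probability

/-! ### The risk-aware control -/

/-- The Kalman predictor in closed loop with the affine feedback `K_t a_t + l_t` of the Kalman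
filter `a_t`. -/
noncomputable def closedLoopPredictor (D : LQProblem n m p Ω) (wbar : Fin n → ℝ)
    (W : Matrix (Fin n) (Fin n) ℝ) (S : Matrix (Fin m) (Fin m) ℝ) (mu : ℝ) : ℕ → Ω → Fin n → ℝ
  | 0 => fun _ => D.x0
  | t + 1 => fun ω => D.A *ᵥ (D.closedLoopPredictor wbar W S mu t ω
        + D.kalmanGain W S t *ᵥ D.residual wbar W S t ω)
      + D.B *ᵥ (D.controlGain W S mu t *ᵥ (D.closedLoopPredictor wbar W S mu t ω
        + D.kalmanGain W S t *ᵥ D.residual wbar W S t ω) + D.controlShift wbar W S mu t) + wbar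

/-- The affine feedback of the Kalman filter, as a function of the noise. -/
noncomputable def closedLoopControl (D : LQProblem n m p Ω) (wbar : Fin n → ℝ)
    (W : Matrix (Fin n) (Fin n) ℝ) (S : Matrix (Fin m) (Fin m) ℝ) (mu : ℝ) (t : ℕ) (ω : Ω) :
    Fin p → ℝ :=
  D.controlGain W S mu t *ᵥ (D.closedLoopPredictor wbar W S mu t ω
    + D.kalmanGain W S t *ᵥ D.residual wbar W S t ω) + D.controlShift wbar W S mu t

section ClosedLoop

variable (D : LQProblem n m p Ω) (wbar : Fin n → ℝ) (W : Matrix (Fin n) (Fin n) ℝ)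
  (S : Matrix (Fin m) (Fin m) ℝ) (mu : ℝ)

lemma predictor_closedLoopControl (t : ℕ) :
    D.predictor wbar W S (D.closedLoopControl wbar W S mu) t
      = D.closedLoopPredictor wbar W S mu t := by
  induction t with
  | zero => rfl
  | succ t ih =>
    rw [predictor_succ]
    simp only [corrector, ih]
    rfl

lemma closedLoopControl_eq (t : ℕ) : D.closedLoopControl wbar W S mu t = fun ω =>
    D.controlGain W S mu t *ᵥ D.corrector wbar W S (D.closedLoopControl wbar W S mu) t ω
      + D.controlShift wbar W S mu t := by
  ext1 ω
  rw [corrector, predictor_closedLoopControl, closedLoopControl]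

lemma measurable_closedLoopControl (t : ℕ) :
    Measurable[D.residualInfo wbar W S (t + 1)] (D.closedLoopControl wbar W S mu t) := by
  induction t using Nat.strong_induction_on with
  | _ t ih =>
    let _ := D.residualInfo wbar W S (t + 1)
    have : Measurable (D.corrector wbar W S (D.closedLoopControl wbar W S mu) t) :=
      measurable_corrector_residualInfo ih
    rw [closedLoopControl_eq]
    fun_prop

end ClosedLoop

section Optimality

variable [MeasurableSpace Ω] {P : Measure Ω} [IsProbabilityMeasure P]
  {D : LQProblem n m p Ω} {wbar : Fin n → ℝ} {W : Matrix (Fin n) (Fin n) ℝ}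
  {S : Matrix (Fin m) (Fin m) ℝ} {mu : ℝ} {u : ℕ → Ω → Fin p → ℝ}

lemma closedLoopControl_mem_admissible (hnoise : IsGaussianNoise P D.w D.v wbar W S) :
    D.closedLoopControl wbar W S mu ∈ D.admissible P := by
  have hLp (t : ℕ) : MemLp (D.closedLoopControl wbar W S mu t) 4 P := by
    induction t using Nat.strong_induction_on with
    | _ t ih =>
      rw [closedLoopControl_eq]
      exact (memLp_mulVec _ (memLp_corrector hnoise ih)).add (memLp_const _)
  refine fun t _ => ⟨?_, hLp t⟩
  rw [obsInfo_eq_residualInfo fun s _ => D.measurable_closedLoopControl wbar W S mu s]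
  exact D.measurable_closedLoopControl wbar W S mu t

lemma closedLoopControl_isRiskAwareControl (hnoise : IsGaussianNoise P D.w D.v wbar W S)
    (hinv : ∀ t, 1 ≤ t → t < D.N → IsUnit (D.C * D.kalmanCov W S t * D.Cᵀ + S).det) :
    D.IsRiskAwareControl P wbar W S mu (D.closedLoopControl wbar W S mu) := by
  intro t ht
  filter_upwards [estimate_ae_eq hnoise hinv (closedLoopControl_mem_admissible hnoise) ht]
    with ω h
  rw [h]
  exact congrFun (D.closedLoopControl_eq wbar W S mu t) ω

lemma excessCost_nonneg (hnoise : IsGaussianNoise P D.w D.v wbar W S)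
    (hQ : D.Q.PosSemidef) (hR : D.R.PosDef)
    (hinv : ∀ t, 1 ≤ t → t < D.N → IsUnit (D.C * D.kalmanCov W S t * D.Cᵀ + S).det)
    (hmu : 0 ≤ mu) {t : ℕ} (ht : t < D.N) : 0 ≤ D.excessCost P wbar W S mu u t :=
  integral_nonneg fun ω => by
    simpa using (D.posDef_quadratic hR
      (posSemidef_costMat_of_noise hnoise hQ hR hinv hmu ht)).posSemidef.dotProduct_mulVec_nonneg
        (D.feedbackGap wbar W S mu u t ω)

lemma excessCost_eq_zero (hnoise : IsGaussianNoise P D.w D.v wbar W S)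
    (hinv : ∀ t, 1 ≤ t → t < D.N → IsUnit (D.C * D.kalmanCov W S t * D.Cᵀ + S).det)
    (hu : u ∈ D.admissible P) (hra : D.IsRiskAwareControl P wbar W S mu u)
    {t : ℕ} (ht : t < D.N) : D.excessCost P wbar W S mu u t = 0 := by
  refine integral_eq_zero_of_ae ?_
  filter_upwards [hra t ht, estimate_ae_eq hnoise hinv hu ht] with ω h1 h2
  rw [feedbackGap, h1, h2, sub_self, zero_dotProduct, Pi.zero_apply]

lemma lagrangian_eq_dualValue (hnoise : IsGaussianNoise P D.w D.v wbar W S)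
    (hQ : D.Q.PosSemidef) (hR : D.R.PosDef)
    (hinv : ∀ t, 1 ≤ t → t < D.N → IsUnit (D.C * D.kalmanCov W S t * D.Cᵀ + S).det)
    (hmu : 0 ≤ mu) (hu : u ∈ D.admissible P) (hra : D.IsRiskAwareControl P wbar W S mu u) :
    ((D.lagrangian P u mu : ℝ) : EReal) = D.dualValue P mu := by
  obtain ⟨c, hc⟩ := exists_lagrangian_eq hnoise hQ hR hinv hmu
  refine le_antisymm (le_iInf₂ fun u' hu' => EReal.coe_le_coe_iff.mpr ?_) (iInf₂_le u hu)
  rw [hc u hu, hc u' hu', Finset.sum_eq_zero fun t ht =>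
    excessCost_eq_zero hnoise hinv hu hra (Finset.mem_range.mp ht), add_zero]
  exact le_add_of_nonneg_right (Finset.sum_nonneg fun t ht =>
    excessCost_nonneg hnoise hQ hR hinv hmu (Finset.mem_range.mp ht))

end Optimality

end LQProblem

theorem mainTheorem3 {n m p : ℕ} {Ω : Type*} [MeasurableSpace Ω] (P : Measure Ω)
    [IsProbabilityMeasure P] (D : LQProblem n m p Ω) (wbar : Fin n → ℝ)
    (W : Matrix (Fin n) (Fin n) ℝ) (S : Matrix (Fin m) (Fin m) ℝ)
    (hnoise : IsGaussianNoise P D.w D.v wbar W S)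
    (hQ : D.Q.PosSemidef) (hR : D.R.PosDef)
    (hinv : ∀ t, 1 ≤ t → t < D.N → IsUnit (D.C * D.kalmanCov W S t * D.Cᵀ + S).det)
    (mu : ℝ) (hmu : 0 ≤ mu) :
    (∀ u ∈ D.admissible P,
      HasGaussianLaw (fun ω (t : Fin (D.N + 1)) => D.innovation P u t ω) P ∧
      (∀ t ≤ D.N,
        HasGaussianLaw (D.innovation P u t) P ∧
        (∀ i, ∫ ω, D.innovation P u t ω i ∂P = 0) ∧
        (∀ i j, covariance (fun ω => D.innovation P u t ω i)
          (fun ω => D.innovation P u t ω j) P = D.kalmanCov W S t i j) ∧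
        Indep (MeasurableSpace.comap (D.innovation P u t) inferInstance) (D.pastInfo u t) P) ∧
      (∀ t < D.N, ∀ᵐ ω ∂P, D.condCov P u t ω = D.kalmanCov W S (t + 1)) ∧
      (∀ t < D.N, ∀ᵐ ω ∂P, D.estimate P u t ω = D.prediction P u t ω
        + D.kalmanGain W S t *ᵥ (D.output u t ω - D.C *ᵥ D.prediction P u t ω))) ∧
    (∃ u ∈ D.admissible P, D.IsRiskAwareControl P wbar W S mu u) ∧
    (∀ u ∈ D.admissible P, D.IsRiskAwareControl P wbar W S mu u →
      ((D.lagrangian P u mu : ℝ) : EReal) = D.dualValue P mu) := by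
  refine ⟨fun u hu => ⟨?_, fun t ht => ?_, fun t ht => LQProblem.condCov_ae_eq hnoise hinv hu ht,
    fun t ht => ?_⟩, ⟨_, LQProblem.closedLoopControl_mem_admissible hnoise,
      LQProblem.closedLoopControl_isRiskAwareControl hnoise hinv⟩,
    fun u hu hra => LQProblem.lagrangian_eq_dualValue hnoise hQ hR hinv hmu hu hra⟩
  · refine (LQProblem.hasGaussianLaw_filterError_pi hnoise D.N).congr ?_
    have h : ∀ᵐ ω ∂P, ∀ t : Fin (D.N + 1),
        D.innovation P u t ω = D.filterError wbar W S t ω :=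
      ae_all_iff.mpr fun t => LQProblem.innovation_ae_eq hnoise hinv hu (Nat.lt_succ_iff.mp t.2)
    filter_upwards [h] with ω h
    exact funext fun t => (h t).symm
  · have h := LQProblem.innovation_ae_eq hnoise hinv hu ht
    have hi (i : Fin n) : (fun ω => D.innovation P u t ω i)
        =ᵐ[P] fun ω => D.filterError wbar W S t ω i := h.fun_comp (· i)
    refine ⟨(LQProblem.hasGaussianLaw_filterError hnoise t).congr h.symm, fun i => ?_,
      fun i j => ?_, ?_⟩
    · rw [integral_congr_ae (hi i), ← eval_integral fun i =>
        (LQProblem.integrable_filterError hnoise t).eval i, LQProblem.integral_filterError hnoise]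
      rfl
    · rw [← (LQProblem.crossCov_filterError hnoise hinv ht).1]
      simp only [crossCov, of_apply, covariance]
      rw [integral_congr_ae (hi i), integral_congr_ae (hi j)]
      refine integral_congr_ae ?_
      filter_upwards [h] with ω h
      rw [h]
    · rw [LQProblem.pastInfo_eq_residualInfo (wbar := wbar) (W := W) (S := S) hu ht]
      exact (LQProblem.indep_filterError hnoise hinv ht).congr h.symm ae_eq_rfl
  · filter_upwards [LQProblem.estimate_ae_eq hnoise hinv hu ht,
      LQProblem.prediction_ae_eq hnoise hinv hu ht.le] with ω h1 h2
    rw [h1, h2, LQProblem.output_eq_add D wbar W S, add_sub_cancel_left]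
    rfl
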